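/- Let $n\ge 2$ and $d\ge 2$ be integers and let $T_d$ be the $d$-th Chebyshev polynomial, $T_d(\cos\theta)=\cos(d\theta)$. Let $f\in S=\mathbb C[x_0,\dots,x_n]$ be the homogenization, by means of $x_0$, of $$T_d(x_1)+\dots+T_d(x_n)\quad (n\text{ even}),\qquad T_d(x_1)+\dots+T_d(x_n)+1\quad (n\text{ odd}),$$ and let $\mathcal C(n,d)\subset\mathbb P^n_{\mathbb C}$ be the Chebyshev hypersurface $f=0$. Let $M(f)=S/(\partial f/\partial x_0,\dots,\partial f/\partial x_n)$ be the graded Milnor algebra of $f$, let $\tau(\mathcal C(n,d))$ be the total Tjurina number of $\mathcal C(n,d)$, i.e. the sum of the Tjurina numbers of its singular points, and let $$st(\mathcal C(n,d))=\min\{q : \dim_{\mathbb C} M(f)_k=\tau(\mathcal C(n,d))\text{ for all }k\ge q\}$$ be its stability threshold. Then, with $T=(n+1)(d-2)$, $$st(\mathcal C(n,d))=T-(d-3)=n(d-2)+1.$$ Moreover, every singular point of $\mathcal C(n,d)$ is a node (an $A_1$-singularity), $\tau(\mathcal C(n,d))$ is the number of nodes, and this number is given by - $\tau(\mathcal C(n,d))=\binom{2n_1}{n_1}d_1^{\,n}$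 if $n=2n_1$ is even and $d=2d_1+1$ is odd; - $\tau(\mathcal C(n,d))=\binom{2n_1}{n_1}d_1^{\,n_1}(d_1-1)^{n_1}$ if $n=2n_1$ is even and $d=2d_1$ is even; - $\tau(\mathcal C(n,d))=\binom{2n_1+1}{n_1}d_1^{\,n_1+1}(d_1-1)^{n_1}$ if $n=2n_1+1$ is odd and $d=2d_1$ is even; - $\tau(\mathcal C(n,d))=\binom{2n_1+1}{n_1}d_1^{\,n}$ if $n=2n_1+1$ is odd and $d=2d_1+1$ is odd. -/

import Mathlib

open scoped LinearAlgebra.Projectivization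

noncomputable section

namespace ChebyshevHypersurface

open MvPolynomial

/-- The homogenization, by means of the new variable `x₀`, of a polynomial `g` in `n` variables:
each monomial of `g` is multiplied by the power of `x₀` that brings its degree to the total degree
of `g`.  The old variables become `x₁, …, xₙ`. -/
def homogenization {n : ℕ} (g : MvPolynomial (Fin n) ℂ) : MvPolynomial (Fin (n + 1)) ℂ :=
  ∑ m ∈ g.support, monomial (Finsupp.cons (g.totalDegree - m.degree) m) (g.coeff m)

/-- The affine equation `T_d(x₁) + ⋯ + T_d(xₙ)` (`n` even), `T_d(x₁) + ⋯ + T_d(xₙ) + 1`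
(`n` odd), where `T_d` is the Chebyshev polynomial of the first kind. -/
def affineEquation (n d : ℕ) : MvPolynomial (Fin n) ℂ :=
  (∑ i : Fin n, Polynomial.aeval (X i : MvPolynomial (Fin n) ℂ) (Polynomial.Chebyshev.T ℂ (d : ℤ)))
    + C (if Even n then 0 else 1)

/-- The homogeneous equation of the Chebyshev hypersurface in `ℙⁿ`. -/
def equation (n d : ℕ) : MvPolynomial (Fin (n + 1)) ℂ :=
  homogenization (affineEquation n d)

/-- The Jacobian ideal, spanned by the partial derivatives of `f`. -/
def jacobianIdeal {n : ℕ} (f : MvPolynomial (Fin (n + 1)) ℂ) :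
    Ideal (MvPolynomial (Fin (n + 1)) ℂ) :=
  Ideal.span (Set.range fun i => pderiv i f)

/-- The degree `k` graded piece of the Milnor algebra `M(f) = S / J_f`: the image of the space
`S_k` of homogeneous polynomials of degree `k`. -/
def milnorPiece {n : ℕ} (f : MvPolynomial (Fin (n + 1)) ℂ) (k : ℕ) :
    Submodule ℂ (MvPolynomial (Fin (n + 1)) ℂ ⧸ jacobianIdeal f) :=
  (homogeneousSubmodule (Fin (n + 1)) ℂ k).map
    (Ideal.Quotient.mkₐ ℂ (jacobianIdeal f)).toLinearMap

/-- The singular points of the projective hypersurface `f = 0` (`f` homogeneous, so that the choice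
of the representative of `p` does not matter). -/
def singularLocus {n : ℕ} (f : MvPolynomial (Fin (n + 1)) ℂ) : Set (ℙ ℂ (Fin (n + 1) → ℂ)) :=
  {p | eval p.rep f = 0 ∧ ∀ i, eval p.rep (pderiv i f) = 0}

open Classical in
/-- The first index `i` with `xᵢ(p) ≠ 0`: `p` lies in the affine chart `xᵢ ≠ 0` of `ℙⁿ`.  The local
notions below do not depend on which affine chart containing `p` is used. -/
def chartIndex {n : ℕ} (p : ℙ ℂ (Fin (n + 1) → ℂ)) : Fin (n + 1) :=
  Fin.find (fun i => p.rep i ≠ 0) (Function.ne_iff.mp p.rep_nonzero)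

/-- The affine coordinates of `p` in its chart. -/
def affineCoords {n : ℕ} (p : ℙ ℂ (Fin (n + 1) → ℂ)) : Fin n → ℂ :=
  fun j => p.rep ((chartIndex p).succAbove j) / p.rep (chartIndex p)

/-- The local equation `f(…, xᵢ = 1, …)` of the hypersurface `f = 0` in the chart `xᵢ ≠ 0`. -/
def dehomogenization {n : ℕ} (i : Fin (n + 1)) (f : MvPolynomial (Fin (n + 1)) ℂ) :
    MvPolynomial (Fin n) ℂ :=
  aeval (i.insertNth (α := fun _ => MvPolynomial (Fin n) ℂ) 1 X) f

instance ker_eval_isPrime {n : ℕ} (a : Fin n → ℂ) :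
    (RingHom.ker (eval a : MvPolynomial (Fin n) ℂ →+* ℂ)).IsPrime :=
  RingHom.ker_isPrime (eval a : MvPolynomial (Fin n) ℂ →+* ℂ)

/-- The local ring of affine `n`-space at `a`. -/
abbrev LocalRingAt {n : ℕ} (a : Fin n → ℂ) : Type :=
  Localization.AtPrime (RingHom.ker (eval a : MvPolynomial (Fin n) ℂ →+* ℂ))

/-- The Tjurina ideal `(g, ∂g/∂x₁, …, ∂g/∂xₙ)` in the local ring at `a`. -/
def tjurinaIdeal {n : ℕ} (g : MvPolynomial (Fin n) ℂ) (a : Fin n → ℂ) : Ideal (LocalRingAt a) :=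
  (Ideal.span (insert g (Set.range fun j => pderiv j g))).map
    (algebraMap (MvPolynomial (Fin n) ℂ) (LocalRingAt a))

/-- The Tjurina number of the affine hypersurface `g = 0` at `a`: the complex dimension (possibly
infinite) of the Tjurina algebra. -/
def tjurinaNumber {n : ℕ} (g : MvPolynomial (Fin n) ℂ) (a : Fin n → ℂ) : ℕ∞ :=
  Cardinal.toENat (Module.rank ℂ (LocalRingAt a ⧸ tjurinaIdeal g a))

/-- The total Tjurina number of the projective hypersurface `f = 0`: the sum of the Tjurina numbers
of its singular points (an unconditional sum in `ℕ∞`). -/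
def totalTjurinaNumber {n : ℕ} (f : MvPolynomial (Fin (n + 1)) ℂ) : ℕ∞ :=
  ∑' p : singularLocus f, tjurinaNumber (dehomogenization (chartIndex p.1) f) (affineCoords p.1)

/-- `q` is the stability threshold of the hypersurface `f = 0`: the least `q` such that
`dim M(f)_k` equals the total Tjurina number for all `k ≥ q`. -/
def IsStabilityThreshold {n : ℕ} (f : MvPolynomial (Fin (n + 1)) ℂ) (q : ℕ) : Prop :=
  IsLeast {q : ℕ | ∀ k, q ≤ k →
    (Module.finrank ℂ (milnorPiece f k) : ℕ∞) = totalTjurinaNumber f} q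

/-- The Hessian matrix of `g` at `a`. -/
def hessian {n : ℕ} (g : MvPolynomial (Fin n) ℂ) (a : Fin n → ℂ) : Matrix (Fin n) (Fin n) ℂ :=
  Matrix.of fun i j => eval a (pderiv i (pderiv j g))

/-- `p` is a node (an `A₁`-singularity, i.e. an ordinary double point) of the hypersurface `f = 0`:
a singular point at which the Hessian of a local equation is nondegenerate. -/
def IsNode {n : ℕ} (f : MvPolynomial (Fin (n + 1)) ℂ) (p : ℙ ℂ (Fin (n + 1) → ℂ)) : Prop :=
  p ∈ singularLocus f ∧
    (hessian (dehomogenization (chartIndex p) f) (affineCoords p)).det ≠ 0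

/-- The number of nodes of the hypersurface `f = 0`. -/
def numberOfNodes {n : ℕ} (f : MvPolynomial (Fin (n + 1)) ℂ) : ℕ∞ :=
  Set.encard {p | IsNode f p}

end ChebyshevHypersurface

end

/-! The partials of `f` along `x₁, …, xₙ` are, up to a constant, `∏ (x_j - q x₀)` over the `d - 1`
simple critical points `q` of `T_d`. They cut out a reduced grid `G` of `(d - 1)ⁿ` points in the
chart `x₀ = 1`. By Euler's relation the remaining partial equals `d F` on `G`, `F` being the affine
equation, so the singular points are the set `N ⊆ G` where `F = 0`. Critical values are `±1`, hence
`N` consists of the grid points with exactly `⌊n/2⌋` coordinates of value `1`; this gives the count.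
Separation of variables and simplicity of the critical points make each singular point a node with
Tjurina number one.

For `k ≥ n(d-2)`, forms of degree `k` take arbitrary values on `G`, and those vanishing on `G` lie
in the Jacobian ideal (`mem_jacobianIdeal_of_vanishing`). So `dim M(f)_k` is `|G|` minus the
dimension of the space of values on `G` of degree `k` forms in the ideal, and these values vanish on
`N`. They fill all functions vanishing on `N` as soon as polynomials of degree `k - (d-1)`
interpolate on `G \ N`. For `k > n(d-2)`, residue duality on the grid (`exists_of_orthogonal`) turns
a failure of interpolation into a nonzero polynomial of degree at most `d - 3` vanishing on `N`,
which `eq_zero_of_vanishing_on_nodeSet` excludes. For `k = n(d-2)` the residue functional kills all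
values from the Jacobian ideal but not the indicator of a point of `G \ N`, so the dimension is too
large (`card_nodeSet_lt_finrank_milnorPiece`). -/

namespace ChebyshevHypersurface

open MvPolynomial

/-! ### Critical points and critical values of `T_d` -/

/-- The critical points `cos (k π / d)`, `0 < k < d`, of the Chebyshev polynomial `T_d`. -/
noncomputable def criticalPoints (d : ℕ) : Finset ℂ :=
  (Finset.Ioo 0 d).image fun k : ℕ => Complex.cos (k * Real.pi / d)

theorem cos_mul_pi_div_injOn (d : ℕ) :
    Set.InjOn (fun k : ℕ => Complex.cos (k * Real.pi / d)) (Finset.Ioo 0 d) := by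
  intro j hj k hk h
  simp only [Finset.coe_Ioo, Set.mem_Ioo] at hj hk
  have hd : (0 : ℝ) < d := by exact_mod_cast hj.1.trans hj.2
  have h' : Real.cos (j * Real.pi / d) = Real.cos (k * Real.pi / d) := by
    apply Complex.ofReal_injective
    push_cast
    exact h
  have hmem : ∀ i : ℕ, i < d → (i * Real.pi / d : ℝ) ∈ Set.Icc 0 Real.pi := by
    intro i hi
    refine ⟨by positivity, ?_⟩
    rw [div_le_iff₀ hd, mul_comm]
    gcongr
  have := Real.injOn_cos (hmem j hj.2) (hmem k hk.2) h'
  field_simp at this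
  exact_mod_cast this

theorem card_criticalPoints (d : ℕ) : (criticalPoints d).card = d - 1 := by
  rw [criticalPoints, Finset.card_image_of_injOn (cos_mul_pi_div_injOn d), Nat.card_Ioo]
  omega

theorem eval_T_cos_mul_pi_div {d : ℕ} (hd : d ≠ 0) (k : ℕ) :
    (Polynomial.Chebyshev.T ℂ d).eval (Complex.cos (k * Real.pi / d)) = (-1) ^ k := by
  have hd' : (d : ℂ) ≠ 0 := by exact_mod_cast hd
  rw [Polynomial.Chebyshev.T_complex_cos]
  push_cast
  rw [show (d : ℂ) * (k * Real.pi / d) = k * Real.pi by field_simp]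
  exact_mod_cast congrArg Complex.ofReal (Real.cos_nat_mul_pi k)

/-- From `U_{d-1}(cos θ) sin θ = sin(dθ)`: at `θ = kπ/d` the right side vanishes and `sin θ` does
not. These `d - 1` distinct roots exhaust the degree, so all are simple. -/
theorem roots_U_pred {d : ℕ} (hd : d ≠ 0) :
    (Polynomial.Chebyshev.U ℂ (d - 1 : ℤ)).roots = (criticalPoints d).val := by
  have hd' : (d : ℂ) ≠ 0 := by exact_mod_cast hd
  apply Polynomial.roots_eq_of_degree_eq_card
  · intro x hx
    obtain ⟨k, hk, rfl⟩ := Finset.mem_image.mp hx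
    rw [Finset.mem_Ioo] at hk
    have hs : Complex.sin (k * Real.pi / d) ≠ 0 := by
      have : Real.sin (k * Real.pi / d) ≠ 0 := by
        apply ne_of_gt
        have h0 : (0 : ℝ) < d := by positivity
        have h1 : (0 : ℝ) < k := by exact_mod_cast hk.1
        have h2 : (k : ℝ) < d := by exact_mod_cast hk.2
        apply Real.sin_pos_of_pos_of_lt_pi (by positivity)
        rw [div_lt_iff₀ h0, mul_comm]
        gcongr
      intro h
      apply this
      apply Complex.ofReal_injective
      push_cast
      exact h
    have := Polynomial.Chebyshev.U_complex_cos (k * Real.pi / d : ℂ) (d - 1 : ℤ)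
    refine (mul_eq_zero.mp (this.trans ?_)).resolve_right hs
    push_cast
    rw [show ((d : ℂ) - 1 + 1) * (k * Real.pi / d) = k * Real.pi by field_simp; ring]
    exact_mod_cast congrArg Complex.ofReal (Real.sin_nat_mul_pi k)
  · rw [card_criticalPoints]
    have : (d - 1 : ℤ) = ((d - 1 : ℕ) : ℤ) := by omega
    rw [this, Polynomial.Chebyshev.degree_U_natCast]

/-- The leading coefficient of the derivative of `T_d`. -/
noncomputable def derivLeadingCoeff (d : ℕ) : ℂ := d * 2 ^ (d - 1)

theorem derivLeadingCoeff_ne_zero {d : ℕ} (hd : d ≠ 0) : derivLeadingCoeff d ≠ 0 := by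
  have hd' : (d : ℂ) ≠ 0 := by exact_mod_cast hd
  exact mul_ne_zero hd' (pow_ne_zero _ two_ne_zero)

theorem derivative_T_eq_prod {d : ℕ} (hd : d ≠ 0) :
    Polynomial.derivative (Polynomial.Chebyshev.T ℂ d) =
      Polynomial.C (derivLeadingCoeff d) *
        ∏ q ∈ criticalPoints d, (Polynomial.X - Polynomial.C q) := by
  have hpred : (d - 1 : ℤ) = ((d - 1 : ℕ) : ℤ) := by omega
  have h := Polynomial.C_leadingCoeff_mul_prod_multiset_X_sub_C
    (p := Polynomial.Chebyshev.U ℂ (d - 1 : ℤ)) (by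
      rw [roots_U_pred hd, hpred, Polynomial.Chebyshev.natDegree_U_natCast]
      exact card_criticalPoints d)
  rw [roots_U_pred hd] at h
  rw [Polynomial.Chebyshev.T_derivative_eq_U]
  push_cast
  rw [← h]
  conv_lhs => rw [hpred, Polynomial.Chebyshev.leadingCoeff_U_natCast]
  rw [derivLeadingCoeff, Polynomial.C_mul, mul_assoc]
  rfl

theorem eval_T_of_mem_criticalPoints {d : ℕ} {x : ℂ} (hx : x ∈ criticalPoints d) :
    (Polynomial.Chebyshev.T ℂ d).eval x = 1 ∨ (Polynomial.Chebyshev.T ℂ d).eval x = -1 := by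
  obtain ⟨k, hk, rfl⟩ := Finset.mem_image.mp hx
  rw [Finset.mem_Ioo] at hk
  rw [eval_T_cos_mul_pi_div (by omega)]
  exact neg_one_pow_eq_or ℂ k

/-- The critical points of `T_d` with critical value `s`. -/
noncomputable def criticalFiber (d : ℕ) (s : ℂ) : Finset ℂ :=
  (criticalPoints d).filter fun x => (Polynomial.Chebyshev.T ℂ d).eval x = s

/-- The critical value at `cos(kπ/d)` is `(-1)^k`, so counting a fiber amounts to counting `k` of a
given parity. -/
theorem card_criticalFiber_neg_one_pow (d e : ℕ) :
    (criticalFiber d ((-1) ^ e)).card =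
      ((Finset.Ioo 0 d).filter fun k => (Even k ↔ Even e)).card := by
  rw [criticalFiber, criticalPoints, Finset.filter_image,
    Finset.card_image_of_injOn ((cos_mul_pi_div_injOn d).mono (by
      exact_mod_cast Finset.filter_subset _ (Finset.Ioo 0 d)))]
  congr 1
  apply Finset.filter_congr
  intro k hk
  rw [Finset.mem_Ioo] at hk
  rw [eval_T_cos_mul_pi_div (by omega)]
  rcases Nat.even_or_odd k with h | h <;> rcases Nat.even_or_odd e with h' | h' <;>
    simp [h.neg_one_pow, h'.neg_one_pow, h, h', Nat.not_even_iff_odd.mpr] <;> norm_num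

theorem card_filter_even_Ioo (d : ℕ) :
    ((Finset.Ioo 0 d).filter Even).card = (d - 1) / 2 := by
  have : (Finset.Ioo 0 d).filter Even = (Finset.Ioc 0 ((d - 1) / 2)).image (2 * ·) := by
    ext k
    simp only [Finset.mem_filter, Finset.mem_Ioo, Finset.mem_image, Finset.mem_Ioc]
    constructor
    · rintro ⟨h, m, rfl⟩
      exact ⟨m, by omega, by omega⟩
    · rintro ⟨m, hm, rfl⟩
      exact ⟨by omega, even_two_mul m⟩
  rw [this, Finset.card_image_of_injective _ (fun a b h => by simpa using h)]
  simp

theorem card_criticalFiber_one (d : ℕ) : (criticalFiber d 1).card = (d - 1) / 2 := by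
  have := card_criticalFiber_neg_one_pow d 0
  simpa [card_filter_even_Ioo] using this

theorem card_criticalFiber_neg_one (d : ℕ) : (criticalFiber d (-1)).card = d / 2 := by
  have h := card_criticalFiber_neg_one_pow d 1
  have h' := Finset.card_filter_add_card_filter_not (s := Finset.Ioo 0 d) Even
  simp only [pow_one, Nat.not_even_one, iff_false] at h
  rw [card_filter_even_Ioo, ← h, Nat.card_Ioo] at h'
  omega

/-! ### The parametrization `x = (z + z⁻¹)/2`, and a Chebyshev identity -/

/-- With `θ = -i log w` one has `exp(iθ) = w`; this carries the trigonometric identities for `T` and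
`U` over to rational identities in a nonzero complex parameter. -/
theorem cos_neg_I_mul_log {w : ℂ} (hw : w ≠ 0) :
    Complex.cos (-Complex.I * Complex.log w) = (w + w⁻¹) / 2 := by
  rw [Complex.cos, show -Complex.I * Complex.log w * Complex.I = Complex.log w by
    linear_combination (-Complex.log w) * Complex.I_sq,
    show -(-Complex.I * Complex.log w) * Complex.I = -Complex.log w by
    linear_combination Complex.log w * Complex.I_sq, Complex.exp_neg, Complex.exp_log hw]

theorem inv_pow_eq_pow {d : ℕ} {z : ℂ} (hz : z ^ (2 * d) = 1) : (z ^ d)⁻¹ = z ^ d :=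
  inv_eq_of_mul_eq_one_right (by rw [← pow_add, ← two_mul, hz])

theorem eval_T_add_inv {z : ℂ} (hz : z ≠ 0) (d : ℕ) :
    (Polynomial.Chebyshev.T ℂ d).eval ((z + z⁻¹) / 2) = (z ^ d + (z ^ d)⁻¹) / 2 := by
  rw [← cos_neg_I_mul_log hz, Polynomial.Chebyshev.T_complex_cos, Complex.cos]
  push_cast
  rw [show (d * (-Complex.I * Complex.log z)) * Complex.I = d * Complex.log z by
      linear_combination (-d * Complex.log z) * Complex.I_sq,
    show -(d * (-Complex.I * Complex.log z)) * Complex.I = -(d * Complex.log z) by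
      linear_combination (d * Complex.log z) * Complex.I_sq, Complex.exp_neg, Complex.exp_nat_mul,
    Complex.exp_log hz]

theorem eval_U_add_inv {z : ℂ} (hz : z ≠ 0) (d : ℕ) :
    (Polynomial.Chebyshev.U ℂ (d - 1 : ℤ)).eval ((z + z⁻¹) / 2) * (z - z⁻¹) =
      z ^ d - (z ^ d)⁻¹ := by
  have hI : Complex.I ≠ 0 := Complex.I_ne_zero
  have := Polynomial.Chebyshev.U_complex_cos (-Complex.I * Complex.log z) (d - 1 : ℤ)
  rw [cos_neg_I_mul_log hz, Complex.sin, Complex.sin] at this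
  push_cast at this
  rw [show -Complex.I * Complex.log z * Complex.I = Complex.log z by
      linear_combination (-Complex.log z) * Complex.I_sq,
      show -(-Complex.I * Complex.log z) * Complex.I = -Complex.log z by
      linear_combination Complex.log z * Complex.I_sq,
      show ((d : ℂ) - 1 + 1) * (-Complex.I * Complex.log z) * Complex.I = d * Complex.log z by
      linear_combination (-d * Complex.log z) * Complex.I_sq,
    show -(((d : ℂ) - 1 + 1) * (-Complex.I * Complex.log z)) * Complex.I = -(d * Complex.log z) by
      linear_combination (d * Complex.log z) * Complex.I_sq, Complex.exp_neg, Complex.exp_neg,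
      Complex.exp_nat_mul, Complex.exp_log hz] at this
  have h2 : (Complex.I / 2) ≠ 0 := by simp
  apply mul_left_cancel₀ h2
  linear_combination -this

/-- When `z^(2d) = 1` the difference `z^d - z^(-d)` vanishes, and `z² ≠ 1` keeps the factor `z -
z⁻¹` from accounting for it; the zero comes from `U_{d-1}`. -/
theorem add_inv_mem_criticalPoints {d : ℕ} (hd : d ≠ 0) {z : ℂ} (hz : z ^ (2 * d) = 1)
    (hz' : z ^ 2 ≠ 1) : (z + z⁻¹) / 2 ∈ criticalPoints d := by
  have hz0 : z ≠ 0 := by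
    rintro rfl
    rw [zero_pow (by omega)] at hz
    exact zero_ne_one hz
  have h := eval_U_add_inv hz0 d
  rw [inv_pow_eq_pow hz, sub_self] at h
  have hne : z - z⁻¹ ≠ 0 := by
    intro h0
    apply hz'
    field_simp at h0
    linear_combination h0
  have hroot := (mul_eq_zero.mp h).resolve_right hne
  rw [← Finset.mem_val, ← roots_U_pred hd, Polynomial.mem_roots]
  · exact hroot
  · exact Polynomial.Chebyshev.U_ne_zero ℂ _ (by omega)

theorem eval_T_add_inv_of_pow_eq_one {d : ℕ} {z : ℂ} (hz : z ^ (2 * d) = 1) (hz0 : z ≠ 0) :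
    (Polynomial.Chebyshev.T ℂ d).eval ((z + z⁻¹) / 2) = z ^ d := by
  rw [eval_T_add_inv hz0, inv_pow_eq_pow hz]
  ring

/-- The polynomial `d T_d` minus `x` times the derivative of `T_d` has degree `d - 2`. -/
theorem mul_T_sub_X_mul_derivative {d : ℕ} (hd : 2 ≤ d) :
    (d : Polynomial ℂ) * Polynomial.Chebyshev.T ℂ d -
        Polynomial.X * Polynomial.derivative (Polynomial.Chebyshev.T ℂ d) =
      -((d : Polynomial ℂ) * Polynomial.Chebyshev.U ℂ ((d - 2 : ℕ) : ℤ)) := by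
  obtain ⟨m, rfl⟩ := Nat.exists_eq_add_of_le' hd
  have h1 := Polynomial.Chebyshev.T_eq_X_mul_U_sub_U ℂ (m : ℤ)
  rw [Polynomial.Chebyshev.T_derivative_eq_U]
  push_cast
  rw [h1, show (m : ℤ) + 2 - 1 = m + 1 by ring]
  ring

/-! ### Homogenization and dehomogenization -/

theorem totalDegree_aeval_le {σ τ : Type*} (f : σ → MvPolynomial τ ℂ)
    (hf : ∀ i, (f i).totalDegree ≤ 1) (g : MvPolynomial σ ℂ) :
    (aeval f g).totalDegree ≤ g.totalDegree := by
  rw [aeval_def, eval₂_eq]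
  refine totalDegree_finsetSum_le fun m hm => ?_
  refine (totalDegree_mul _ _).trans ?_
  rw [algebraMap_eq, totalDegree_C, zero_add]
  refine (totalDegree_finsetProd _ _).trans ?_
  refine le_trans (Finset.sum_le_sum fun i _ => ?_) (le_totalDegree hm)
  refine (totalDegree_pow _ _).trans ?_
  simpa using Nat.mul_le_mul_left (m i) (hf i)

/-- The homogenization of `g` in degree `k`, meant for `k` at least the degree of `g`. -/
noncomputable def homogenizeAt {n : ℕ} (k : ℕ) (g : MvPolynomial (Fin n) ℂ) :
    MvPolynomial (Fin (n + 1)) ℂ :=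
  ∑ m ∈ g.support, monomial (Finsupp.cons (k - m.degree) m) (g.coeff m)

theorem isHomogeneous_homogenizeAt {n k : ℕ} {g : MvPolynomial (Fin n) ℂ}
    (hg : g.totalDegree ≤ k) : (homogenizeAt k g).IsHomogeneous k := by
  refine IsHomogeneous.sum _ _ _ fun m hm => isHomogeneous_monomial _ ?_
  have : m.degree ≤ k := (le_totalDegree hm).trans hg
  rw [Finsupp.degree_eq_sum, Fin.sum_univ_succ]
  simp only [Finsupp.cons_zero, Finsupp.cons_succ]
  rw [← Finsupp.degree_eq_sum]
  omega

theorem dehomogenization_homogenizeAt {n k : ℕ} (g : MvPolynomial (Fin n) ℂ) :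
    dehomogenization 0 (homogenizeAt k g) = g := by
  conv_rhs => rw [g.as_sum]
  rw [dehomogenization, homogenizeAt, map_sum]
  refine Finset.sum_congr rfl fun m _ => ?_
  rw [aeval_monomial, monomial_eq, Finsupp.prod_fintype _ _ (by simp), Fin.prod_univ_succ,
    Finsupp.prod_fintype _ _ (by simp)]
  simp [algebraMap_eq, Fin.insertNth_zero']

theorem eval_dehomogenization_zero {n : ℕ} (F : MvPolynomial (Fin (n + 1)) ℂ) (a : Fin n → ℂ) :
    eval a (dehomogenization 0 F) = eval (Fin.cons 1 a) F := by
  rw [dehomogenization, aeval_def, eval₂_eq, map_sum, eval_eq]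
  refine Finset.sum_congr rfl fun m _ => ?_
  simp only [map_mul, map_prod, algebraMap_eq, eval_C, map_pow]
  congr 1
  refine Finset.prod_congr rfl fun i _ => ?_
  congr 1
  refine Fin.cases ?_ (fun j => ?_) i <;> simp [Fin.insertNth_zero']

theorem eval_smul_of_isHomogeneous {σ : Type*} {k : ℕ} {F : MvPolynomial σ ℂ}
    (hF : F.IsHomogeneous k) (c : ℂ) (x : σ → ℂ) : eval (c • x) F = c ^ k * eval x F := by
  rw [eval_eq, eval_eq, Finset.mul_sum]
  refine Finset.sum_congr rfl fun m hm => ?_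
  simp only [Pi.smul_apply, smul_eq_mul, mul_pow, Finset.prod_mul_distrib]
  rw [Finset.prod_pow_eq_pow_sum, ← hF.degree_eq_sum_deg_support hm]
  ring

theorem eval_eq_pow_mul_eval_dehomogenization {n k : ℕ} {F : MvPolynomial (Fin (n + 1)) ℂ}
    (hF : F.IsHomogeneous k) {x : Fin (n + 1) → ℂ} (hx : x 0 ≠ 0) :
    eval x F = x 0 ^ k * eval (fun j => x j.succ / x 0) (dehomogenization 0 F) := by
  rw [eval_dehomogenization_zero, ← eval_smul_of_isHomogeneous hF]
  congr 2
  ext i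
  refine Fin.cases ?_ (fun j => ?_) i
  · simp
  · simp [mul_div_cancel₀ _ hx]

theorem eval_affineEquation (n d : ℕ) (a : Fin n → ℂ) :
    eval a (affineEquation n d) =
      ∑ i, (Polynomial.Chebyshev.T ℂ d).eval (a i) + if Even n then 0 else 1 := by
  rw [affineEquation, map_add, map_sum, eval_C]
  congr 1
  refine Finset.sum_congr rfl fun i _ => ?_
  rw [← Polynomial.coe_aeval_eq_eval, ← coe_aeval_eq_eval, RingHom.coe_coe,
    ← Polynomial.aeval_algHom_apply, aeval_X]

/-! ### Low-degree polynomials vanishing at the nodes -/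

/-- The affine singular points of the Chebyshev hypersurface. -/
noncomputable def nodeSet (n d : ℕ) : Finset (Fin n → ℂ) :=
  (Fintype.piFinset fun _ => criticalPoints d).filter fun a => eval a (affineEquation n d) = 0

theorem mem_nodeSet {n d : ℕ} {a : Fin n → ℂ} :
    a ∈ nodeSet n d ↔ (∀ i, a i ∈ criticalPoints d) ∧ eval a (affineEquation n d) = 0 := by
  simp [nodeSet]

theorem eval_aeval_polynomial {σ : Type*} (f : σ → Polynomial ℂ) (h : MvPolynomial σ ℂ) (t : ℂ) :
    (aeval f h).eval t = eval (fun i => (f i).eval t) h := by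
  rw [← Polynomial.coe_aeval_eq_eval, ← coe_aeval_eq_eval, RingHom.coe_coe,
    ← AlgHom.comp_apply, comp_aeval]

theorem eq_or_mul_eq_one_of_add_inv_eq {a b : ℂ} (ha : a ≠ 0) (hb : b ≠ 0)
    (h : (a + a⁻¹) / 2 = (b + b⁻¹) / 2) : a = b ∨ a * b = 1 := by
  have : (a - b) * (a * b - 1) = 0 := by
    field_simp at h
    linear_combination h
  rcases mul_eq_zero.mp this with h | h
  · exact Or.inl (sub_eq_zero.mp h)
  · exact Or.inr (sub_eq_zero.mp h)

/-- For `w^d = -1` this parametrized rational curve lies on `T_d(x) + T_d(y) = 0`. At least `2d - 4`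
parameters with `z^(2d) = 1` give nodes, whereas the pullback of `h`, cleared of denominators, has
degree at most `2 deg h ≤ 2d - 6`. -/
theorem eval_eq_zero_on_conic {d : ℕ} {h : MvPolynomial (Fin 2) ℂ} (hdeg : h.totalDegree + 3 ≤ d)
    (hh : ∀ a ∈ nodeSet 2 d, eval a h = 0) {w : ℂ} (hw : w ^ d = -1) {z : ℂ} (hz : z ≠ 0) :
    eval ![(z * w + (z * w)⁻¹) / 2, (z + z⁻¹) / 2] h = 0 := by
  have hw0 : w ≠ 0 := by
    rintro rfl
    rw [zero_pow (by omega)] at hw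
    norm_num at hw
  -- Homogenizing `h` and putting `u` in the extra variable multiplies the pullback by `u ^ deg h`,
  -- which clears the denominators of both coordinates.
  set Q : Polynomial ℂ := aeval ![Polynomial.X,
    Polynomial.C (w / 2) * Polynomial.X ^ 2 + Polynomial.C (w⁻¹ / 2),
    Polynomial.C (1 / 2) * Polynomial.X ^ 2 + Polynomial.C (1 / 2)]
    (homogenizeAt h.totalDegree h) with hQ
  have hQdeg : Q.natDegree ≤ h.totalDegree * 2 := by
    refine aeval_natDegree_le _ (isHomogeneous_homogenizeAt le_rfl).totalDegree_le _ ?_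
    intro i
    fin_cases i
    · simp
    · exact Polynomial.natDegree_add_C.trans_le (Polynomial.natDegree_C_mul_X_pow_le _ _)
    · exact Polynomial.natDegree_add_C.trans_le (Polynomial.natDegree_C_mul_X_pow_le _ _)
  have hQeval : ∀ u : ℂ, u ≠ 0 → Q.eval u =
      u ^ h.totalDegree * eval ![(u * w + (u * w)⁻¹) / 2, (u + u⁻¹) / 2] h := by
    intro u hu
    have h1 : Q.eval u = eval ![u, w / 2 * u ^ 2 + w⁻¹ / 2, 1 / 2 * u ^ 2 + 1 / 2]
        (homogenizeAt h.totalDegree h) := by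
      rw [hQ, eval_aeval_polynomial]
      congr 2
      ext i
      fin_cases i <;> simp
    rw [h1, eval_eq_pow_mul_eval_dehomogenization (isHomogeneous_homogenizeAt le_rfl) (by simpa),
      dehomogenization_homogenizeAt]
    congr 3
    ext i
    fin_cases i
    · simp
      field_simp
    · simp
      field_simp
  have hprim := Complex.isPrimitiveRoot_exp (2 * d) (by omega)
  have hprim2 := Complex.isPrimitiveRoot_exp 2 (by omega)
  -- The removed roots are those with `u² = 1` or `(uw)² = 1`, at most four, where one coordinate is
  -- `±1` and hence not known to be critical.
  set R := Polynomial.nthRootsFinset (2 * d) (1 : ℂ) \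
    (Polynomial.nthRootsFinset 2 (1 : ℂ) ∪
      (Polynomial.nthRootsFinset 2 (1 : ℂ)).image (· / w)) with hR
  have hRcard : h.totalDegree * 2 < R.card := by
    have h1 : _ ≤ R.card := Finset.le_card_sdiff (Polynomial.nthRootsFinset 2 (1 : ℂ) ∪
      (Polynomial.nthRootsFinset 2 (1 : ℂ)).image (· / w))
      (Polynomial.nthRootsFinset (2 * d) (1 : ℂ))
    have h2 := Finset.card_union_le (Polynomial.nthRootsFinset 2 (1 : ℂ))
      ((Polynomial.nthRootsFinset 2 (1 : ℂ)).image (· / w))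
    have h3 := Finset.card_image_le (s := Polynomial.nthRootsFinset 2 (1 : ℂ)) (f := (· / w))
    rw [hprim.card_nthRootsFinset] at h1
    rw [hprim2.card_nthRootsFinset] at h2 h3
    omega
  have hQ0 : Q = 0 := by
    refine Polynomial.eq_zero_of_natDegree_lt_card_of_eval_eq_zero' Q R ?_ (by omega)
    intro u hu
    rw [hR, Finset.mem_sdiff, Finset.mem_union, not_or,
      Polynomial.mem_nthRootsFinset (by omega), Polynomial.mem_nthRootsFinset (by omega)] at hu
    obtain ⟨hu1, hu2, hu3⟩ := hu
    have hu0 : u ≠ 0 := by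
      rintro rfl
      rw [zero_pow (by omega)] at hu1
      exact zero_ne_one hu1
    have huw : (u * w) ^ (2 * d) = 1 := by
      rw [mul_pow, hu1, mul_comm 2 d, pow_mul, hw]
      norm_num
    have huw2 : (u * w) ^ 2 ≠ 1 := by
      intro h2
      apply hu3
      rw [Finset.mem_image]
      exact ⟨u * w, (Polynomial.mem_nthRootsFinset (by omega) _).mpr h2, by field_simp⟩
    rw [hQeval u hu0, hh, mul_zero]
    rw [mem_nodeSet]
    constructor
    · intro i
      fin_cases i
      · exact add_inv_mem_criticalPoints (by omega) huw huw2
      · exact add_inv_mem_criticalPoints (by omega) hu1 hu2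
    · rw [eval_affineEquation, Fin.sum_univ_two]
      simp only [Matrix.cons_val_zero, Matrix.cons_val_one]
      rw [eval_T_add_inv_of_pow_eq_one huw (mul_ne_zero hu0 hw0),
        eval_T_add_inv_of_pow_eq_one hu1 hu0, mul_pow, hw]
      simp
  have := hQeval z hz
  rw [hQ0, Polynomial.eval_zero, eq_comm, mul_eq_zero] at this
  exact this.resolve_left (pow_ne_zero _ hz)

/-- A line `y = (z + z⁻¹)/2` with `z^(2d) ≠ 1` meets the curves attached to the `d` roots of `w^d =
-1` in `d` distinct points, more than the degree of `h`. So `h` vanishes on infinitely many parallel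
lines. -/
theorem eq_zero_of_vanishing_on_nodeSet_two {d : ℕ} {h : MvPolynomial (Fin 2) ℂ}
    (hdeg : h.totalDegree + 3 ≤ d) (hh : ∀ a ∈ nodeSet 2 d, eval a h = 0) : h = 0 := by
  obtain ⟨ω, hω⟩ := IsAlgClosed.exists_pow_nat_eq (-1 : ℂ) (show 0 < d by omega)
  have hω0 : ω ≠ 0 := by
    rintro rfl
    rw [zero_pow (by omega)] at hω
    norm_num at hω
  have hline : ∀ z : ℂ, z ≠ 0 → z ^ (2 * d) ≠ 1 → ∀ x : ℂ, eval ![x, (z + z⁻¹) / 2] h = 0 := by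
    intro z hz hzd x
    set p : Polynomial ℂ := aeval ![Polynomial.X, Polynomial.C ((z + z⁻¹) / 2)] h with hp
    have hpdeg : p.natDegree ≤ h.totalDegree * 1 := by
      refine aeval_natDegree_le _ le_rfl _ fun i => ?_
      fin_cases i <;> simp
    have hpeval : ∀ y : ℂ, p.eval y = eval ![y, (z + z⁻¹) / 2] h := by
      intro y
      rw [hp, eval_aeval_polynomial]
      congr 2
      ext i
      fin_cases i <;> simp
    have hprim := Complex.isPrimitiveRoot_exp d (by omega)
    have hpow : ∀ μ ∈ Polynomial.nthRootsFinset d (1 : ℂ), (ω * μ) ^ d = -1 := by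
      intro μ hμ
      rw [Polynomial.mem_nthRootsFinset (by omega)] at hμ
      rw [mul_pow, hμ, hω, mul_one]
    have hne : ∀ μ ∈ Polynomial.nthRootsFinset d (1 : ℂ), z * (ω * μ) ≠ 0 := by
      intro μ hμ
      refine mul_ne_zero hz fun h0 => ?_
      have := hpow μ hμ
      rw [h0, zero_pow (by omega)] at this
      norm_num at this
    have hp0 : p = 0 := by
      refine Polynomial.eq_zero_of_natDegree_lt_card_of_eval_eq_zero' p
        ((Polynomial.nthRootsFinset d (1 : ℂ)).image
          fun μ => (z * (ω * μ) + (z * (ω * μ))⁻¹) / 2) ?_ ?_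
      · intro y hy
        obtain ⟨μ, hμ, rfl⟩ := Finset.mem_image.mp hy
        rw [hpeval]
        exact eval_eq_zero_on_conic hdeg hh (hpow μ hμ) hz
      · rw [Finset.card_image_of_injOn, hprim.card_nthRootsFinset]
        · omega
        · intro μ hμ ν hν hμν
          rcases eq_or_mul_eq_one_of_add_inv_eq (hne μ hμ) (hne ν hν) hμν with h1 | h1
          · exact mul_left_cancel₀ hω0 (mul_left_cancel₀ hz h1)
          -- Two parameters with product `1` would give the same point; the `d`-th power of that
          -- product is `z^(2d) · (-1)²`, which was assumed different from `1`.
          · exfalso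
            apply hzd
            have h2 : (z * (ω * μ) * (z * (ω * ν))) ^ d =
                z ^ (2 * d) * ((ω * μ) ^ d * (ω * ν) ^ d) := by ring
            rw [h1, hpow μ hμ, hpow ν hν, one_pow] at h2
            linear_combination -h2
    rw [← hpeval, hp0, Polynomial.eval_zero]
  -- The parameters `z = k + 2` are integers above `1`: they are not roots of unity, and no two have
  -- product `1`, so the resulting heights are distinct.
  refine funext_set ![Set.univ, Set.range fun k : ℕ => ((k + 2 : ℂ) + (k + 2 : ℂ)⁻¹) / 2] ?_ ?_
  · intro i
    fin_cases i
    · exact Set.infinite_univ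
    · refine Set.infinite_range_of_injective fun j k hjk => ?_
      have hne : ∀ i : ℕ, (i + 2 : ℂ) ≠ 0 := fun i => by exact_mod_cast (by omega : i + 2 ≠ 0)
      rcases eq_or_mul_eq_one_of_add_inv_eq (hne j) (hne k) hjk with h1 | h1
      · exact_mod_cast add_right_cancel h1
      · exfalso
        have h2 : (j + 2) * (k + 2) = 1 := by exact_mod_cast h1
        have := Nat.eq_one_of_mul_eq_one_right h2
        omega
  · intro x hx
    obtain ⟨k, hk⟩ := hx 1 (Set.mem_univ _)
    have hk2 : (k + 2 : ℂ) ≠ 0 := by exact_mod_cast (by omega : k + 2 ≠ 0)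
    have hkd : (k + 2 : ℂ) ^ (2 * d) ≠ 1 := by
      have : 1 < (k + 2) ^ (2 * d) := Nat.one_lt_pow (by omega) (by omega)
      exact_mod_cast this.ne'
    have hx' : x = ![x 0, ((k + 2 : ℂ) + (k + 2 : ℂ)⁻¹) / 2] := by
      ext i
      fin_cases i
      · rfl
      · exact hk.symm
    rw [hx', hline _ hk2 hkd, map_zero]

/-- Through a point where `h ≠ 0`, a line of general direction in the plane of the first two
coordinates meets the hyperplanes `x₀ ∈ B` and `x₁ ∈ B` at `2|B|` distinct parameters, too many for
the degree. -/
theorem eq_zero_of_vanishing_on_slices {n : ℕ} (B : Finset ℂ) {h : MvPolynomial (Fin (n + 2)) ℂ}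
    (hdeg : h.totalDegree < 2 * B.card)
    (hh : ∀ (i : Fin (n + 2)) (x : Fin (n + 2) → ℂ), x i ∈ B → eval x h = 0) : h = 0 := by
  by_contra h0
  obtain ⟨b, hb⟩ : ∃ b, eval b h ≠ 0 := by
    by_contra! hall
    exact h0 (MvPolynomial.funext fun x => by rw [hall x, map_zero])
  have hbB : ∀ i, ∀ q ∈ B, q - b i ≠ 0 := fun i q hq hqb =>
    hb (hh i b (sub_eq_zero.mp hqb ▸ hq))
  -- The slope `v` avoids the finitely many values for which the line would meet a hyperplane of
  -- each family at the same parameter.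
  obtain ⟨v, hv⟩ := Set.Infinite.exists_notMem_finset (Set.infinite_univ (α := ℂ))
    (insert 0 ((B ×ˢ B).image fun q => (q.2 - b 1) / (q.1 - b 0)))
  simp only [Set.mem_univ, Finset.mem_insert, Finset.mem_image, Finset.mem_product, not_or,
    true_and] at hv
  obtain ⟨hv0, hv⟩ := hv
  let f : Fin (n + 2) → ℂ := Fin.cons 1 (Fin.cons v 0)
  let p : Polynomial ℂ :=
    aeval (fun i => Polynomial.C (f i) * Polynomial.X + Polynomial.C (b i)) h
  have hpdeg : p.natDegree ≤ h.totalDegree * 1 :=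
    aeval_natDegree_le _ le_rfl _ fun i => Polynomial.natDegree_linear_le
  have hpeval : ∀ τ : ℂ, p.eval τ = eval (fun i => f i * τ + b i) h := by
    intro τ
    simp [p, eval_aeval_polynomial]
  have hp0 : p = 0 := by
    refine Polynomial.eq_zero_of_natDegree_lt_card_of_eval_eq_zero' p
      (B.image (fun q => q - b 0) ∪ B.image fun q => (q - b 1) / v) ?_ ?_
    · intro τ hτ
      rw [hpeval]
      rcases Finset.mem_union.mp hτ with hτ | hτ
      · obtain ⟨q, hq, rfl⟩ := Finset.mem_image.mp hτ
        apply hh 0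
        simpa [f] using hq
      · obtain ⟨q, hq, rfl⟩ := Finset.mem_image.mp hτ
        apply hh 1
        have : f 1 = v := rfl
        simpa [this, mul_div_cancel₀ _ hv0] using hq
    · rw [Finset.card_union_of_disjoint, Finset.card_image_of_injective,
        Finset.card_image_of_injective]
      · omega
      · intro x y hxy
        simpa [hv0] using hxy
      · intro x y hxy
        simpa using hxy
      · rw [Finset.disjoint_left]
        intro τ h1 h2
        obtain ⟨q, hq, rfl⟩ := Finset.mem_image.mp h1
        obtain ⟨q', hq', h3⟩ := Finset.mem_image.mp h2
        refine hv ⟨(q, q'), ⟨hq, hq'⟩, ?_⟩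
        have := hbB 0 q hq
        field_simp at h3 ⊢
        linear_combination h3
  apply hb
  have := hpeval 0
  rw [hp0, Polynomial.eval_zero] at this
  simpa using this.symm

/-- No nonzero polynomial of degree at most `d - 3` vanishes at all nodes. -/
theorem eq_zero_of_vanishing_on_nodeSet {n d : ℕ} (hn : 2 ≤ n) {h : MvPolynomial (Fin n) ℂ}
    (hdeg : h.totalDegree + 3 ≤ d) (hh : ∀ a ∈ nodeSet n d, eval a h = 0) : h = 0 := by
  induction n, hn using Nat.le_induction with
  | base => exact eq_zero_of_vanishing_on_nodeSet_two hdeg hh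
  | succ n hn ih =>
    obtain ⟨m, rfl⟩ := Nat.exists_eq_add_of_le' hn
    -- Adding a coordinate changes the parity of the dimension, hence the constant term of the
    -- equation; the critical value `s` compensates for it, so slices at height of value `s` contain
    -- the nodes of one dimension less.
    let s : ℂ := if Even (m + 2) then -1 else 1
    have hB : d ≤ 2 * (criticalFiber d s).card + 2 := by
      simp only [s]
      split_ifs
      · rw [card_criticalFiber_neg_one]
        omega
      · rw [card_criticalFiber_one]
        omega
    refine eq_zero_of_vanishing_on_slices (n := m + 1) (criticalFiber d s) (by omega) ?_
    intro i x hx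
    let g : MvPolynomial (Fin (m + 2)) ℂ := aeval (i.insertNth (C (x i)) X) h
    have hgdeg : g.totalDegree ≤ h.totalDegree := by
      refine totalDegree_aeval_le _ (fun j => ?_) h
      refine i.succAboveCases ?_ (fun j => ?_) j
      · simp
      · simp [totalDegree_X]
    have hgeval : ∀ a, eval a g = eval (i.insertNth (x i) a) h := by
      intro a
      rw [← coe_aeval_eq_eval, ← coe_aeval_eq_eval, RingHom.coe_coe, RingHom.coe_coe]
      simp only [g]
      rw [← AlgHom.comp_apply, comp_aeval]
      congr 2
      ext j
      refine i.succAboveCases ?_ (fun j => ?_) j <;> simp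
    have hg : g = 0 := by
      refine ih (by omega) fun a ha => ?_
      rw [hgeval]
      apply hh
      rw [mem_nodeSet] at ha ⊢
      obtain ⟨hxc, hxs⟩ := Finset.mem_filter.mp hx
      constructor
      · intro j
        refine i.succAboveCases ?_ (fun j => ?_) j
        · simpa using hxc
        · simpa using ha.1 j
      · have h2 := ha.2
        rw [eval_affineEquation] at h2 ⊢
        rw [Fin.sum_univ_succAbove _ i]
        simp only [Fin.insertNth_apply_same, Fin.insertNth_apply_succAbove, hxs]
        simp only [s]
        rcases Nat.even_or_odd (m + 2) with he | ho
        · have ho : ¬ Even (m + 2 + 1) := by simpa [Nat.even_add_one] using he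
          simp only [he, ho, if_true, if_false] at h2 ⊢
          linear_combination h2
        · have he : Even (m + 2 + 1) := ho.add_one
          simp only [Nat.not_even_iff_odd.mpr ho, he, if_true, if_false] at h2 ⊢
          linear_combination h2
    have := hgeval (i.removeNth x)
    rw [hg, map_zero, Fin.insertNth_self_removeNth] at this
    exact this.symm

/-! ### The residue pairing on the critical grid -/

/-- The points of affine `n`-space with all coordinates critical points of `T_d`. -/
noncomputable def criticalGrid (n d : ℕ) : Finset (Fin n → ℂ) :=
  Fintype.piFinset fun _ => criticalPoints d

theorem mem_criticalGrid {n d : ℕ} {a : Fin n → ℂ} :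
    a ∈ criticalGrid n d ↔ ∀ i, a i ∈ criticalPoints d :=
  Fintype.mem_piFinset

theorem nodeSet_subset_criticalGrid (n d : ℕ) : nodeSet n d ⊆ criticalGrid n d :=
  Finset.filter_subset _ _

/-- The weight of a critical point in the residue pairing. -/
noncomputable def criticalWeight (d : ℕ) (q : ℂ) : ℂ :=
  (∏ j ∈ (criticalPoints d).erase q, (q - j))⁻¹

theorem criticalWeight_ne_zero (d : ℕ) (q : ℂ) : criticalWeight d q ≠ 0 := by
  rw [criticalWeight, ne_eq, inv_eq_zero, Finset.prod_eq_zero_iff]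
  rintro ⟨j, hj, h⟩
  exact (Finset.mem_erase.mp hj).1 (sub_eq_zero.mp h).symm

/-- The left side is Lagrange's formula for the coefficient of degree `d - 2` in the interpolant
through the `d - 1` critical points, and `X ^ e` is its own interpolant. -/
theorem sum_criticalWeight_mul_pow {d : ℕ} (hd : 2 ≤ d) {e : ℕ} (he : e ≤ d - 2) :
    ∑ q ∈ criticalPoints d, criticalWeight d q * q ^ e = if e = d - 2 then 1 else 0 := by
  have h := Lagrange.coeff_eq_sum (s := criticalPoints d) (v := id) (P := Polynomial.X ^ e)
    Function.injective_id.injOn (by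
      rw [Polynomial.degree_X_pow, card_criticalPoints]
      exact_mod_cast (by omega : e < d - 1))
  rw [card_criticalPoints, Polynomial.coeff_X_pow] at h
  have h2 : d - 1 - 1 = d - 2 := by omega
  rw [h2] at h
  rw [show (if e = d - 2 then (1 : ℂ) else 0) = if d - 2 = e then 1 else 0 by simp [eq_comm], h]
  refine Finset.sum_congr rfl fun q _ => ?_
  simp [criticalWeight, div_eq_inv_mul]

/-- The weight of a point of the critical grid in the residue pairing. -/
noncomputable def gridWeight {n : ℕ} (d : ℕ) (a : Fin n → ℂ) : ℂ := ∏ i, criticalWeight d (a i)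

theorem gridWeight_ne_zero {n : ℕ} (d : ℕ) (a : Fin n → ℂ) : gridWeight d a ≠ 0 :=
  Finset.prod_ne_zero_iff.mpr fun i _ => criticalWeight_ne_zero d (a i)

/-- The exponent `(d - 2, …, d - 2)` of the socle of the critical grid. -/
noncomputable def socleExponent (n d : ℕ) : Fin n →₀ ℕ := Finsupp.equivFunOnFinite.symm fun _ => d - 2

theorem degree_socleExponent (n d : ℕ) : (socleExponent n d).degree = n * (d - 2) := by
  simp [socleExponent, Finsupp.degree_eq_sum]

/-- On a monomial the sum factors over the coordinates. Within the degree bound, every monomial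
other than the socle one has some exponent below `d - 2`, and that factor is zero. -/
theorem sum_gridWeight_mul_eval {n d : ℕ} (hd : 2 ≤ d) {h : MvPolynomial (Fin n) ℂ}
    (hh : h.totalDegree ≤ n * (d - 2)) :
    ∑ a ∈ criticalGrid n d, gridWeight d a * eval a h = h.coeff (socleExponent n d) := by
  have key : ∀ m ∈ h.support, ∑ a ∈ criticalGrid n d, gridWeight d a * ∏ i, a i ^ m i =
      if m = socleExponent n d then 1 else 0 := by
    intro m hm
    have h1 : ∑ a ∈ criticalGrid n d, gridWeight d a * ∏ i, a i ^ m i =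
        ∏ i, ∑ q ∈ criticalPoints d, criticalWeight d q * q ^ m i := by
      rw [Finset.prod_univ_sum]
      refine Finset.sum_congr rfl fun a _ => ?_
      rw [gridWeight, Finset.prod_mul_distrib]
    rw [h1]
    split_ifs with hms
    · subst hms
      refine Finset.prod_eq_one fun i _ => ?_
      exact (sum_criticalWeight_mul_pow hd le_rfl).trans (if_pos rfl)
    · obtain ⟨i, hi⟩ : ∃ i, m i < d - 2 := by
        by_contra! hall
        apply hms
        have hle : m.degree ≤ n * (d - 2) := (le_totalDegree hm).trans hh
        rw [Finsupp.degree_eq_sum] at hle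
        have hsum : ∑ _i : Fin n, (d - 2) = ∑ i, m i := by
          refine le_antisymm (Finset.sum_le_sum fun i _ => hall i) ?_
          simpa using hle
        have := (Finset.sum_eq_sum_iff_of_le fun i _ => hall i).mp hsum
        ext i
        simpa [socleExponent] using (this i (Finset.mem_univ i)).symm
      refine Finset.prod_eq_zero (Finset.mem_univ i) ?_
      rw [sum_criticalWeight_mul_pow hd hi.le, if_neg hi.ne]
  simp_rw [eval_eq', Finset.mul_sum]
  rw [Finset.sum_comm]
  have : ∀ m ∈ h.support, ∑ a ∈ criticalGrid n d,
      gridWeight d a * (coeff m h * ∏ i, a i ^ m i) =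
        if m = socleExponent n d then coeff m h else 0 := by
    intro m hm
    rw [← mul_one (coeff m h), ← mul_zero (coeff m h), ← mul_ite, ← key m hm, Finset.mul_sum]
    refine Finset.sum_congr rfl fun a _ => ?_
    ring
  rw [Finset.sum_congr rfl this, Finset.sum_ite_eq']
  split_ifs with hs
  · rfl
  · exact (notMem_support_iff.mp hs).symm

theorem degreeOf_aeval_X_le {σ : Type*} [DecidableEq σ] (i j : σ) (p : Polynomial ℂ) :
    degreeOf j (Polynomial.aeval (X i : MvPolynomial σ ℂ) p) ≤
      if i = j then p.natDegree else 0 := by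
  rw [Polynomial.aeval_eq_sum_range]
  refine (degreeOf_sum_le _ _ _).trans (Finset.sup_le fun k hk => ?_)
  rw [smul_eq_C_mul]
  refine (degreeOf_C_mul_le _ _ _).trans ?_
  split_ifs with h
  · subst h
    rw [degreeOf_X_self_pow]
    exact Nat.lt_succ_iff.mp (Finset.mem_range.mp hk)
  · rw [degreeOf_X_pow_of_ne _ (Ne.symm h)]

/-- Products of one-variable Lagrange basis polynomials interpolate. The bound in each variable
separately is what makes every monomial of `u` divide the socle monomial. -/
theorem exists_interpolation {n d : ℕ} (v : (Fin n → ℂ) → ℂ) :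
    ∃ u : MvPolynomial (Fin n) ℂ, (∀ i, u.degreeOf i ≤ d - 2) ∧
      ∀ a ∈ criticalGrid n d, eval a u = v a := by
  let L : (Fin n → ℂ) → MvPolynomial (Fin n) ℂ := fun b =>
    ∏ i, Polynomial.aeval (X i) (Lagrange.basis (criticalPoints d) id (b i))
  refine ⟨∑ b ∈ criticalGrid n d, C (v b) * L b, fun j => ?_, fun a ha => ?_⟩
  · refine (degreeOf_sum_le _ _ _).trans (Finset.sup_le fun b hb => ?_)
    refine (degreeOf_C_mul_le _ _ _).trans ((degreeOf_prod_le _ _ _).trans ?_)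
    refine (Finset.sum_le_sum fun i _ => degreeOf_aeval_X_le i j _).trans ?_
    rw [Finset.sum_ite_eq' Finset.univ j, if_pos (Finset.mem_univ j),
      Lagrange.natDegree_basis Function.injective_id.injOn (mem_criticalGrid.mp hb j),
      card_criticalPoints]
    omega
  · have hL : ∀ b, eval a (L b) =
        ∏ i, (Lagrange.basis (criticalPoints d) id (b i)).eval (a i) := by
      intro b
      simp only [L, map_prod]
      refine Finset.prod_congr rfl fun i _ => ?_
      rw [← Polynomial.coe_aeval_eq_eval, ← coe_aeval_eq_eval, RingHom.coe_coe,
        ← Polynomial.aeval_algHom_apply, aeval_X]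
    rw [map_sum, Finset.sum_eq_single a]
    · rw [map_mul, eval_C, hL, Finset.prod_eq_one, mul_one]
      intro i _
      exact Lagrange.eval_basis_self (v := id) Function.injective_id.injOn (mem_criticalGrid.mp ha i)
    · intro b _ hba
      obtain ⟨i, hi⟩ := Function.ne_iff.mp hba
      rw [map_mul, hL, Finset.prod_eq_zero (Finset.mem_univ i), mul_zero]
      exact Lagrange.eval_basis_of_ne (v := id) hi (mem_criticalGrid.mp ha i)
    · exact fun h => absurd ha h

theorem totalDegree_le_of_degreeOf_le {n e : ℕ} {u : MvPolynomial (Fin n) ℂ}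
    (hu : ∀ i, u.degreeOf i ≤ e) : u.totalDegree ≤ n * e := by
  refine Finset.sup_le fun m hm => ?_
  change m.degree ≤ _
  rw [Finsupp.degree_eq_sum]
  refine (Finset.sum_le_sum fun i _ => (degreeOf_le_iff.mp (hu i)) m hm).trans ?_
  simp

/-- A function on the critical grid orthogonal to all polynomials of degree at most
`(n - 1) (d - 2)` is given, up to the weights, by a polynomial of degree at most `d - 3`. -/
theorem exists_of_orthogonal {n d : ℕ} (hn : 1 ≤ n) (hd : 2 ≤ d) (v : (Fin n → ℂ) → ℂ)
    (hv : ∀ h : MvPolynomial (Fin n) ℂ, h.totalDegree ≤ (n - 1) * (d - 2) →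
      ∑ a ∈ criticalGrid n d, v a * eval a h = 0) :
    ∃ u : MvPolynomial (Fin n) ℂ, (u ≠ 0 → u.totalDegree + 3 ≤ d) ∧
      ∀ a ∈ criticalGrid n d, v a = gridWeight d a * eval a u := by
  obtain ⟨u, hu, huv⟩ := exists_interpolation (d := d) fun a => v a / gridWeight d a
  have huv' : ∀ a ∈ criticalGrid n d, v a = gridWeight d a * eval a u := fun a ha => by
    rw [huv a ha, mul_div_cancel₀ _ (gridWeight_ne_zero d a)]
  refine ⟨u, fun hu0 => ?_, huv'⟩
  by_contra! hdeg
  have htot := totalDegree_le_of_degreeOf_le hu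
  obtain ⟨m, hm, hmdeg⟩ : ∃ m ∈ u.support, m.degree = u.totalDegree := by
    obtain ⟨m, hm, h⟩ := Finset.exists_mem_eq_sup u.support (support_nonempty.mpr hu0)
      fun m => m.degree
    exact ⟨m, hm, h.symm⟩
  have hmle : m ≤ socleExponent n d := fun i => by
    simpa [socleExponent] using degreeOf_le_iff.mp (hu i) m hm
  -- For a monomial `m` of top degree in `u`, the complement `b` has degree at most `(n-1)(d-2)` if
  -- `deg u ≥ d - 2`. Pairing `u` with `b` reads off the coefficient of `m`, while orthogonality
  -- makes it zero.
  obtain ⟨b, hb⟩ := exists_add_of_le hmle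
  have hbdeg : m.degree + b.degree = n * (d - 2) := by
    rw [← degree_socleExponent, hb, map_add]
  have hn' : n * (d - 2) = (n - 1) * (d - 2) + (d - 2) := by
    obtain ⟨k, rfl⟩ := Nat.exists_eq_add_of_le' hn
    simp [add_mul]
  have h1 := sum_gridWeight_mul_eval hd (h := u * monomial b 1) (by
    refine (totalDegree_mul _ _).trans ?_
    rw [totalDegree_monomial _ one_ne_zero]
    change _ + b.degree ≤ _
    omega)
  have h2 := hv (monomial b 1) (by
    rw [totalDegree_monomial _ one_ne_zero]
    change b.degree ≤ _
    omega)
  rw [hb, coeff_mul_monomial, mul_one] at h1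
  apply mem_support_iff.mp hm
  rw [← h1, ← h2]
  refine Finset.sum_congr rfl fun a ha => ?_
  rw [map_mul, huv' a ha, mul_assoc]

/-! ### The equation and its partial derivatives -/

theorem pderiv_affineEquation (n d : ℕ) (j : Fin n) :
    pderiv j (affineEquation n d) =
      Polynomial.aeval (X j) (Polynomial.derivative (Polynomial.Chebyshev.T ℂ d)) := by
  rw [affineEquation, map_add, pderiv_C, add_zero, map_sum, Finset.sum_eq_single j]
  · rw [Derivation.map_aeval, pderiv_X_self, smul_eq_mul, mul_one]
  · intro i _ hij
    rw [Derivation.map_aeval, pderiv_X_of_ne hij, smul_zero]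
  · simp

theorem pderiv_affineEquation_eq_prod {n d : ℕ} (hd : d ≠ 0) (j : Fin n) :
    pderiv j (affineEquation n d) =
      C (derivLeadingCoeff d) * ∏ q ∈ criticalPoints d, (X j - C q) := by
  rw [pderiv_affineEquation, derivative_T_eq_prod hd, map_mul, map_prod]
  simp [algebraMap_eq]

theorem totalDegree_aeval_X_le {n : ℕ} (i : Fin n) (p : Polynomial ℂ) :
    (Polynomial.aeval (X i : MvPolynomial (Fin n) ℂ) p).totalDegree ≤ p.natDegree := by
  rw [Polynomial.aeval_eq_sum_range]
  refine totalDegree_finsetSum_le fun k hk => ?_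
  refine (totalDegree_smul_le _ _).trans ?_
  rw [totalDegree_X_pow]
  exact Nat.lt_succ_iff.mp (Finset.mem_range.mp hk)

theorem totalDegree_affineEquation {n d : ℕ} (hn : 1 ≤ n) :
    (affineEquation n d).totalDegree = d := by
  have hnat : (Polynomial.Chebyshev.T ℂ d).natDegree = d := by
    rw [Polynomial.Chebyshev.natDegree_T, Int.natAbs_natCast]
  apply le_antisymm
  · refine (totalDegree_add _ _).trans (max_le (totalDegree_finsetSum_le fun i _ => ?_) ?_)
    · exact (totalDegree_aeval_X_le _ _).trans hnat.le
    · rw [totalDegree_C]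
      exact Nat.zero_le d
  · -- restrict to a coordinate axis
    let i₀ : Fin n := ⟨0, hn⟩
    let p : Polynomial ℂ :=
      aeval (fun i => if i = i₀ then Polynomial.X else 0) (affineEquation n d)
    have hp : p.natDegree ≤ (affineEquation n d).totalDegree * 1 := by
      refine aeval_natDegree_le _ le_rfl _ fun i => ?_
      split_ifs <;> simp
    obtain ⟨c, hc⟩ : ∃ c, p = Polynomial.Chebyshev.T ℂ d + Polynomial.C c := by
      refine ⟨(n - 1 : ℕ) * (Polynomial.Chebyshev.T ℂ d).eval 0 + if Even n then 0 else 1, ?_⟩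
      refine Polynomial.funext fun t => ?_
      simp only [p, eval_aeval_polynomial, eval_affineEquation]
      rw [← Finset.add_sum_erase _ _ (Finset.mem_univ i₀)]
      rw [Finset.sum_congr rfl (g := fun _ => (Polynomial.Chebyshev.T ℂ d).eval 0)]
      · simp only [if_true, Polynomial.eval_X, Finset.sum_const, Finset.card_erase_of_mem
          (Finset.mem_univ i₀), Finset.card_univ, Fintype.card_fin, nsmul_eq_mul, add_assoc,
          Polynomial.eval_add, Polynomial.eval_C]
      · intro i hi
        simp [Finset.ne_of_mem_erase hi]
    rw [hc, Polynomial.natDegree_add_C, hnat] at hp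
    omega

theorem equation_eq_homogenizeAt {n d : ℕ} (hn : 1 ≤ n) :
    equation n d = homogenizeAt d (affineEquation n d) := by
  rw [equation, homogenization, homogenizeAt, totalDegree_affineEquation hn]

theorem isHomogeneous_equation {n d : ℕ} (hn : 1 ≤ n) :
    (equation n d).IsHomogeneous d := by
  rw [equation_eq_homogenizeAt hn]
  exact isHomogeneous_homogenizeAt (totalDegree_affineEquation hn).le

theorem dehomogenization_equation {n d : ℕ} (hn : 1 ≤ n) :
    dehomogenization 0 (equation n d) = affineEquation n d := by
  rw [equation_eq_homogenizeAt hn, dehomogenization_homogenizeAt]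

theorem dehomogenization_pderiv_succ {n : ℕ} (F : MvPolynomial (Fin (n + 1)) ℂ) (j : Fin n) :
    dehomogenization 0 (pderiv j.succ F) = pderiv j (dehomogenization 0 F) := by
  induction F using MvPolynomial.induction_on with
  | C a => simp [dehomogenization, algebraMap_eq]
  | add p q hp hq =>
    simp only [dehomogenization, map_add] at hp hq ⊢
    rw [hp, hq]
  | mul_X p i hp =>
    simp only [dehomogenization, Derivation.leibniz, map_mul, map_add, smul_eq_mul, aeval_X] at hp ⊢
    rw [hp]
    refine Fin.cases ?_ (fun i => ?_) i
    · simp [Fin.insertNth_zero', pderiv_X_of_ne (Fin.succ_ne_zero j).symm]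
    · by_cases h : i = j
      · subst h
        simp [Fin.insertNth_zero']
      · rw [pderiv_X_of_ne (fun h' => h (Fin.succ_injective _ h'))]
        simp [Fin.insertNth_zero', pderiv_X_of_ne h]

/-- The two forms agree wherever `x₀ ≠ 0`, so `x₀ (F - G)` vanishes everywhere. -/
theorem eq_of_dehomogenization_eq {n k : ℕ} {F G : MvPolynomial (Fin (n + 1)) ℂ}
    (hF : F.IsHomogeneous k) (hG : G.IsHomogeneous k)
    (h : dehomogenization 0 F = dehomogenization 0 G) : F = G := by
  have h0 : X 0 * (F - G) = 0 := by
    refine MvPolynomial.funext fun x => ?_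
    rw [map_mul, eval_X, map_sub, map_zero]
    by_cases hx : x 0 = 0
    · rw [hx, zero_mul]
    · rw [eval_eq_pow_mul_eval_dehomogenization hF hx,
        eval_eq_pow_mul_eval_dehomogenization hG hx, h, sub_self, mul_zero]
  exact sub_eq_zero.mp ((mul_eq_zero.mp h0).resolve_left (X_ne_zero _))

theorem totalDegree_X_sub_C {σ : Type*} (j : σ) (q : ℂ) :
    (X j - C q : MvPolynomial σ ℂ).totalDegree = 1 := by
  rw [sub_eq_add_neg, totalDegree_add_eq_left_of_totalDegree_lt, totalDegree_X]
  rw [← C_neg, totalDegree_C, totalDegree_X]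
  exact one_pos

theorem X_sub_C_ne_zero {σ : Type*} (j : σ) (q : ℂ) : (X j - C q : MvPolynomial σ ℂ) ≠ 0 := by
  intro h
  have := totalDegree_X_sub_C j q
  rw [h, totalDegree_zero] at this
  exact zero_ne_one this

theorem prod_X_sub_C_ne_zero {σ : Type*} (S : Finset ℂ) (j : σ) :
    ∏ q ∈ S, (X j - C q : MvPolynomial σ ℂ) ≠ 0 :=
  Finset.prod_ne_zero_iff.mpr fun q _ => X_sub_C_ne_zero j q

theorem totalDegree_prod_X_sub_C {σ : Type*} (S : Finset ℂ) (j : σ) :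
    (∏ q ∈ S, (X j - C q : MvPolynomial σ ℂ)).totalDegree = S.card := by
  induction S using Finset.induction_on with
  | empty => simp
  | insert q S hq ih =>
    rw [Finset.prod_insert hq, totalDegree_mul_of_isDomain (X_sub_C_ne_zero j q)
      (prod_X_sub_C_ne_zero S j), totalDegree_X_sub_C, ih, Finset.card_insert_of_notMem hq, add_comm]

theorem isHomogeneous_prod_X_sub_C_mul_X {n : ℕ} (S : Finset ℂ) (j : Fin n) :
    (∏ q ∈ S, (X j.succ - C q * X 0 : MvPolynomial (Fin (n + 1)) ℂ)).IsHomogeneous S.card := by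
  have := IsHomogeneous.prod S (fun q => (X j.succ - C q * X 0 : MvPolynomial (Fin (n + 1)) ℂ))
    (fun _ => 1) fun q _ => (isHomogeneous_X _ _).sub (isHomogeneous_C_mul_X _ _)
  simpa using this

theorem dehomogenization_prod_X_sub_C_mul_X {n : ℕ} (S : Finset ℂ) (j : Fin n) :
    dehomogenization 0 (∏ q ∈ S, (X j.succ - C q * X 0 : MvPolynomial (Fin (n + 1)) ℂ)) =
      ∏ q ∈ S, (X j - C q) := by
  simp [dehomogenization, Fin.insertNth_zero', algebraMap_eq]

theorem pderiv_succ_equation {n d : ℕ} (hn : 1 ≤ n) (hd : 1 ≤ d) (j : Fin n) :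
    pderiv j.succ (equation n d) =
      C (derivLeadingCoeff d) * ∏ q ∈ criticalPoints d, (X j.succ - C q * X 0) := by
  refine eq_of_dehomogenization_eq (k := d - 1) (isHomogeneous_equation hn).pderiv ?_ ?_
  · rw [← card_criticalPoints]
    exact (isHomogeneous_prod_X_sub_C_mul_X _ j).C_mul _
  · rw [dehomogenization_pderiv_succ, dehomogenization_equation hn,
      pderiv_affineEquation_eq_prod (by omega), ← dehomogenization_prod_X_sub_C_mul_X]
    simp [dehomogenization, algebraMap_eq]

theorem eval_pderiv_succ_equation {n d : ℕ} (hn : 1 ≤ n) (hd : 1 ≤ d) (j : Fin n)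
    (x : Fin (n + 1) → ℂ) :
    eval x (pderiv j.succ (equation n d)) =
      derivLeadingCoeff d * ∏ q ∈ criticalPoints d, (x j.succ - q * x 0) := by
  rw [pderiv_succ_equation hn hd]
  simp [map_prod]

/-- In Euler's relation at `(1, a)` every term but the one for `x₀` vanishes, because the other
partials are zero on the grid. -/
theorem eval_pderiv_zero_equation {n d : ℕ} (hn : 1 ≤ n) (hd : 1 ≤ d) {a : Fin n → ℂ}
    (ha : a ∈ criticalGrid n d) :
    eval (Fin.cons 1 a : Fin (n + 1) → ℂ) (pderiv 0 (equation n d)) =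
      d * eval a (affineEquation n d) := by
  have h := congrArg (eval (Fin.cons 1 a : Fin (n + 1) → ℂ))
    (isHomogeneous_equation (d := d) hn).sum_X_mul_pderiv
  rw [Fin.sum_univ_succ, map_add, map_sum, Finset.sum_eq_zero, add_zero] at h
  · simpa [← dehomogenization_equation hn, eval_dehomogenization_zero] using h
  · intro j _
    rw [map_mul, eval_pderiv_succ_equation hn hd,
      Finset.prod_eq_zero (mem_criticalGrid.mp ha j) (by simp)]
    simp

/-- On the critical grid, `d` times the affine equation is a polynomial of degree at most
`d - 2`. -/
theorem exists_totalDegree_le_eval_eq {n d : ℕ} (hd : 2 ≤ d) :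
    ∃ u : MvPolynomial (Fin n) ℂ, u.totalDegree ≤ d - 2 ∧
      ∀ a ∈ criticalGrid n d, eval a u = d * eval a (affineEquation n d) := by
  -- At a critical point `x T_d'` is zero, so `d T_d` may be replaced by `d T_d - x T_d' = -d
  -- U_{d-2}`, which lowers the degree by two without changing values.
  refine ⟨∑ i : Fin n, Polynomial.aeval (X i : MvPolynomial (Fin n) ℂ)
    (-((d : Polynomial ℂ) * Polynomial.Chebyshev.U ℂ ((d - 2 : ℕ) : ℤ))) +
      C ((d : ℂ) * if Even n then 0 else 1), ?_, ?_⟩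
  · refine (totalDegree_add _ _).trans (max_le (totalDegree_finsetSum_le fun i _ => ?_) ?_)
    · refine (totalDegree_aeval_X_le _ _).trans ?_
      rw [Polynomial.natDegree_neg, ← map_natCast Polynomial.C]
      refine (Polynomial.natDegree_C_mul_le _ _).trans ?_
      rw [Polynomial.Chebyshev.natDegree_U_natCast]
    · rw [totalDegree_C]
      exact Nat.zero_le _
  · intro a ha
    rw [eval_affineEquation, map_add, map_sum, eval_C, mul_add, Finset.mul_sum]
    congr 1
    refine Finset.sum_congr rfl fun i _ => ?_
    rw [← mul_T_sub_X_mul_derivative hd, ← coe_aeval_eq_eval, RingHom.coe_coe,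
      ← Polynomial.aeval_algHom_apply, aeval_X, Polynomial.coe_aeval_eq_eval,
      derivative_T_eq_prod (by omega)]
    have : ∏ q ∈ criticalPoints d, (a i - q) = 0 :=
      Finset.prod_eq_zero (mem_criticalGrid.mp ha i) (sub_self _)
    simp [Polynomial.eval_prod, this]

/-! ### The Milnor algebra through values on the grid -/

/-- The combinatorial Nullstellensatz writes the dehomogenization as a combination of the `∏ (X_i -
q)` without exceeding its degree, so the combination homogenizes back in degree `k`. Only the
partials along `x₁, …, xₙ` are needed. -/
theorem mem_jacobianIdeal_of_vanishing {n d k : ℕ} (hn : 1 ≤ n) (hd : 2 ≤ d)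
    {H : MvPolynomial (Fin (n + 1)) ℂ} (hH : H.IsHomogeneous k)
    (h0 : ∀ a ∈ criticalGrid n d, eval (Fin.cons 1 a : Fin (n + 1) → ℂ) H = 0) :
    H ∈ jacobianIdeal (equation n d) := by
  have hne : (criticalPoints d).Nonempty := by
    rw [← Finset.card_pos, card_criticalPoints]
    omega
  have hdeg : (dehomogenization 0 H).totalDegree ≤ k := by
    refine (totalDegree_aeval_le _ (fun i => ?_) H).trans hH.totalDegree_le
    refine Fin.cases ?_ (fun j => ?_) i <;> simp [Fin.insertNth_zero', totalDegree_X]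
  obtain ⟨h, hhdeg, hh⟩ := combinatorial_nullstellensatz_exists_linearCombination
    (fun _ : Fin n => criticalPoints d) (fun _ => hne) (dehomogenization 0 H) fun a ha => by
      rw [eval_dehomogenization_zero]
      exact h0 a (mem_criticalGrid.mpr ha)
  rw [Finsupp.linearCombination_apply, Finsupp.sum_fintype _ _ (by simp)] at hh
  have hprod : ∀ i : Fin n, (∏ q ∈ criticalPoints d,
      (X i.succ - C q * X 0 : MvPolynomial (Fin (n + 1)) ℂ)) ∈ jacobianIdeal (equation n d) := by
    intro i
    have hmem : pderiv i.succ (equation n d) ∈ jacobianIdeal (equation n d) :=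
      Ideal.subset_span ⟨i.succ, rfl⟩
    rw [pderiv_succ_equation hn (by omega)] at hmem
    have h1 := Ideal.mul_mem_left _ (C (derivLeadingCoeff d)⁻¹) hmem
    rwa [← mul_assoc, ← C_mul, inv_mul_cancel₀ (derivLeadingCoeff_ne_zero (by omega)), C_1,
      one_mul] at h1
  have hnat : ∀ i, h i ≠ 0 → d - 1 + (h i).totalDegree ≤ k := by
    intro i hi
    have h1 := (hhdeg i).trans hdeg
    rwa [totalDegree_mul_of_isDomain (prod_X_sub_C_ne_zero _ _) hi, totalDegree_prod_X_sub_C,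
      card_criticalPoints] at h1
  have hHsum : H = ∑ i, homogenizeAt (k - (d - 1)) (h i) *
      ∏ q ∈ criticalPoints d, (X i.succ - C q * X 0) := by
    refine eq_of_dehomogenization_eq hH (IsHomogeneous.sum _ _ _ fun i _ => ?_) ?_
    -- The degree bound holds only for nonzero `h i`; otherwise the subtraction `k - (d - 1)` may
    -- truncate.
    · by_cases hi : h i = 0
      · simp [hi, homogenizeAt, isHomogeneous_zero]
      · have h1 := hnat i hi
        have h2 := (isHomogeneous_homogenizeAt (k := k - (d - 1)) (g := h i) (by omega)).mul
          (isHomogeneous_prod_X_sub_C_mul_X (criticalPoints d) i)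
        rw [card_criticalPoints] at h2
        convert h2 using 1
        omega
    · conv_lhs => rw [hh]
      rw [dehomogenization, map_sum]
      refine Finset.sum_congr rfl fun i _ => ?_
      rw [map_mul, smul_eq_mul, ← dehomogenization, ← dehomogenization,
        dehomogenization_homogenizeAt, dehomogenization_prod_X_sub_C_mul_X]
  rw [hHsum]
  exact Ideal.sum_mem _ fun i _ => Ideal.mul_mem_left _ _ (hprod i)

/-- Since `φ` factors through `ε`, composing with a linear section of `ε` reduces the claim to
rank-nullity on `N`; `V` may have any dimension. -/
theorem finrank_range_add_finrank_map_ker {V M N : Type*} [AddCommGroup V] [Module ℂ V]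
    [AddCommGroup M] [Module ℂ M] [AddCommGroup N] [Module ℂ N] [FiniteDimensional ℂ N]
    (φ : V →ₗ[ℂ] M) (ε : V →ₗ[ℂ] N) (hε : Function.Surjective ε)
    (hker : LinearMap.ker ε ≤ LinearMap.ker φ) :
    Module.finrank ℂ (LinearMap.range φ) + Module.finrank ℂ ((LinearMap.ker φ).map ε) =
      Module.finrank ℂ N := by
  obtain ⟨σ, hσ⟩ := ε.exists_rightInverse_of_surjective (LinearMap.range_eq_top.mpr hε)
  have hσ' : ∀ x, ε (σ x) = x := fun x => LinearMap.congr_fun hσ x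
  have hφ : ∀ x, φ (σ (ε x)) = φ x := fun x => by
    have : x - σ (ε x) ∈ LinearMap.ker φ := hker (by simp [hσ'])
    rw [LinearMap.mem_ker, map_sub, sub_eq_zero] at this
    exact this.symm
  have hrange : LinearMap.range (φ ∘ₗ σ) = LinearMap.range φ := by
    ext y
    constructor
    · rintro ⟨x, rfl⟩
      exact ⟨σ x, rfl⟩
    · rintro ⟨x, rfl⟩
      exact ⟨ε x, hφ x⟩
  have hkerσ : LinearMap.ker (φ ∘ₗ σ) = (LinearMap.ker φ).map ε := by
    ext y
    constructor
    · intro hy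
      exact ⟨σ y, hy, hσ' y⟩
    · rintro ⟨x, hx, rfl⟩
      exact (hφ x).trans hx
  rw [← hrange, ← hkerσ]
  exact LinearMap.finrank_range_add_finrank_ker _

/-- Evaluation of forms of degree `k` at the points `(1, a)`, `a` in the critical grid. -/
noncomputable def gridEval (n d k : ℕ) :
    homogeneousSubmodule (Fin (n + 1)) ℂ k →ₗ[ℂ] (criticalGrid n d → ℂ) where
  toFun H a := eval (Fin.cons 1 a.1 : Fin (n + 1) → ℂ) H.1
  map_add' _ _ := by ext; simp
  map_smul' _ _ := by ext; simp [smul_eval]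

/-- The canonical map from the forms of degree `k` to the Milnor algebra. -/
noncomputable def toMilnorAlgebra {n : ℕ} (f : MvPolynomial (Fin (n + 1)) ℂ) (k : ℕ) :
    homogeneousSubmodule (Fin (n + 1)) ℂ k →ₗ[ℂ]
      (MvPolynomial (Fin (n + 1)) ℂ ⧸ jacobianIdeal f) :=
  (Ideal.Quotient.mkₐ ℂ (jacobianIdeal f)).toLinearMap ∘ₗ (homogeneousSubmodule _ ℂ k).subtype

theorem range_toMilnorAlgebra {n : ℕ} (f : MvPolynomial (Fin (n + 1)) ℂ) (k : ℕ) :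
    LinearMap.range (toMilnorAlgebra f k) = milnorPiece f k := by
  rw [toMilnorAlgebra, LinearMap.range_comp, Submodule.range_subtype, milnorPiece]

theorem mem_ker_toMilnorAlgebra {n : ℕ} {f : MvPolynomial (Fin (n + 1)) ℂ} {k : ℕ}
    {H : homogeneousSubmodule (Fin (n + 1)) ℂ k} :
    H ∈ LinearMap.ker (toMilnorAlgebra f k) ↔ H.1 ∈ jacobianIdeal f := by
  rw [LinearMap.mem_ker]
  exact Ideal.Quotient.eq_zero_iff_mem

theorem gridEval_surjective {n d k : ℕ} (hk : n * (d - 2) ≤ k) :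
    Function.Surjective (gridEval n d k) := by
  classical
  intro v
  obtain ⟨u, hu, huv⟩ := exists_interpolation (n := n) (d := d)
    fun a => if ha : a ∈ criticalGrid n d then v ⟨a, ha⟩ else 0
  have hdeg : u.totalDegree ≤ k := (totalDegree_le_of_degreeOf_le hu).trans hk
  refine ⟨⟨homogenizeAt k u, isHomogeneous_homogenizeAt hdeg⟩, ?_⟩
  ext ⟨a, ha⟩
  change eval (Fin.cons 1 a : Fin (n + 1) → ℂ) (homogenizeAt k u) = _
  rw [← eval_dehomogenization_zero, dehomogenization_homogenizeAt, huv a ha, dif_pos ha]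

/-- The values on the critical grid of the forms of degree `k` in the Jacobian ideal. -/
noncomputable def jacobianValues (n d k : ℕ) : Submodule ℂ (criticalGrid n d → ℂ) :=
  (LinearMap.ker (toMilnorAlgebra (equation n d) k)).map (gridEval n d k)

theorem finrank_milnorPiece_add {n d k : ℕ} (hn : 1 ≤ n) (hd : 2 ≤ d) (hk : n * (d - 2) ≤ k) :
    Module.finrank ℂ (milnorPiece (equation n d) k) +
      Module.finrank ℂ (jacobianValues n d k) = (criticalGrid n d).card := by
  rw [← range_toMilnorAlgebra, jacobianValues, finrank_range_add_finrank_map_ker _ _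
    (gridEval_surjective hk) fun H hH => ?_]
  · simp
  · rw [mem_ker_toMilnorAlgebra]
    refine mem_jacobianIdeal_of_vanishing hn hd H.2 fun a ha => ?_
    exact congrFun (LinearMap.mem_ker.mp hH) ⟨a, ha⟩

/-! ### Degrees above `n(d-2)`: the dimension is the number of nodes -/

/-- Restriction of functions from the critical grid to the nodes. -/
noncomputable def restrictToNodes (n d : ℕ) :
    (criticalGrid n d → ℂ) →ₗ[ℂ] (nodeSet n d → ℂ) :=
  LinearMap.funLeft ℂ ℂ fun a => ⟨a.1, nodeSet_subset_criticalGrid n d a.2⟩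

theorem mem_ker_restrictToNodes {n d : ℕ} {v : criticalGrid n d → ℂ} :
    v ∈ LinearMap.ker (restrictToNodes n d) ↔ ∀ a, a.1 ∈ nodeSet n d → v a = 0 := by
  rw [LinearMap.mem_ker, funext_iff]
  exact ⟨fun h a ha => h ⟨a.1, ha⟩, fun h a => h _ a.2⟩

theorem finrank_ker_restrictToNodes_add (n d : ℕ) :
    (nodeSet n d).card + Module.finrank ℂ (LinearMap.ker (restrictToNodes n d)) =
      (criticalGrid n d).card := by
  have hsurj : Function.Surjective (restrictToNodes n d) :=
    LinearMap.funLeft_surjective_of_injective ℂ ℂ _ fun a b h =>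
      Subtype.ext (congrArg (fun x : criticalGrid n d => x.1) h)
  have := LinearMap.finrank_range_add_finrank_ker (restrictToNodes n d)
  rw [LinearMap.range_eq_top.mpr hsurj, finrank_top] at this
  simpa using this

theorem eval_eq_zero_of_mem_jacobianIdeal {n d : ℕ} (hn : 1 ≤ n) (hd : 1 ≤ d)
    {H : MvPolynomial (Fin (n + 1)) ℂ} (hH : H ∈ jacobianIdeal (equation n d)) {a : Fin n → ℂ}
    (ha : a ∈ nodeSet n d) : eval (Fin.cons 1 a : Fin (n + 1) → ℂ) H = 0 := by
  have hle : jacobianIdeal (equation n d) ≤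
      RingHom.ker (eval (Fin.cons 1 a : Fin (n + 1) → ℂ)) := by
    rw [jacobianIdeal, Ideal.span_le]
    rintro _ ⟨i, rfl⟩
    have hgrid := nodeSet_subset_criticalGrid n d ha
    refine Fin.cases ?_ (fun j => ?_) i
    · change eval _ _ = 0
      rw [eval_pderiv_zero_equation hn hd hgrid, (mem_nodeSet.mp ha).2, mul_zero]
    · change eval _ _ = 0
      rw [eval_pderiv_succ_equation hn hd,
        Finset.prod_eq_zero (mem_criticalGrid.mp hgrid j) (by simp), mul_zero]
  exact hle hH

theorem jacobianValues_le {n d k : ℕ} (hn : 1 ≤ n) (hd : 1 ≤ d) :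
    jacobianValues n d k ≤ LinearMap.ker (restrictToNodes n d) := by
  rintro _ ⟨H, hH, rfl⟩
  rw [mem_ker_restrictToNodes]
  intro a ha
  exact eval_eq_zero_of_mem_jacobianIdeal hn hd (mem_ker_toMilnorAlgebra.mp hH) ha

/-- Polynomials of degree at most `(n - 1) (d - 2)` take arbitrary values at the points of the
critical grid which are not nodes. -/
theorem exists_totalDegree_le_forall_eval_eq {n d : ℕ} (hn : 2 ≤ n) (hd : 2 ≤ d)
    (v : ↥(criticalGrid n d \ nodeSet n d) → ℂ) :
    ∃ h : MvPolynomial (Fin n) ℂ, h.totalDegree ≤ (n - 1) * (d - 2) ∧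
      ∀ a, eval a.1 h = v a := by
  classical
  let ε : restrictTotalDegree (Fin n) ℂ ((n - 1) * (d - 2)) →ₗ[ℂ]
      (↥(criticalGrid n d \ nodeSet n d) → ℂ) :=
    { toFun := fun h a => eval a.1 h.1
      map_add' := fun _ _ => by ext; simp
      map_smul' := fun _ _ => by ext; simp [smul_eval] }
  suffices hε : LinearMap.range ε = ⊤ by
    obtain ⟨h, hh⟩ := LinearMap.range_eq_top.mp hε v
    exact ⟨h.1, (mem_restrictTotalDegree _ _ _).mp h.2, fun a => congrFun hh a⟩
  by_contra hne
  -- A nonzero functional killing the image, extended by zero to the nodes, is orthogonal to all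
  -- polynomials of degree at most `(n-1)(d-2)`. By duality it comes from a polynomial of degree at
  -- most `d - 3` vanishing at the nodes, hence from zero.
  obtain ⟨φ, hφ0, hφ⟩ := (LinearMap.range ε).exists_le_ker_of_lt_top (lt_top_iff_ne_top.mpr hne)
  let c : (Fin n → ℂ) → ℂ := fun a =>
    if ha : a ∈ criticalGrid n d \ nodeSet n d then φ (Pi.single ⟨a, ha⟩ 1) else 0
  have hφc : ∀ g : (Fin n → ℂ) → ℂ, φ (fun a => g a.1) = ∑ a ∈ criticalGrid n d, c a * g a := by
    intro g
    rw [← Finset.sum_subset (Finset.sdiff_subset (s := criticalGrid n d) (t := nodeSet n d))]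
    · rw [← Finset.sum_coe_sort, ← Finset.univ_sum_single
        fun a : ↥(criticalGrid n d \ nodeSet n d) => g a.1, map_sum]
      refine Finset.sum_congr rfl fun a _ => ?_
      have : (Pi.single a (g a.1) : ↥(criticalGrid n d \ nodeSet n d) → ℂ) =
          g a.1 • Pi.single a 1 := by
        rw [← Pi.single_smul, smul_eq_mul, mul_one]
      rw [this, map_smul, smul_eq_mul, mul_comm]
      simp only [c]
      rw [dif_pos a.2]
    · intro a _ ha
      simp only [c]
      rw [dif_neg ha, zero_mul]
  obtain ⟨u, hu, huc⟩ := exists_of_orthogonal (by omega) hd c fun h hh => by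
    rw [← hφc fun a => eval a h]
    exact hφ ⟨⟨h, (mem_restrictTotalDegree _ _ _).mpr hh⟩, rfl⟩
  have hu0 : u = 0 := by
    by_contra hu0
    refine hu0 (eq_zero_of_vanishing_on_nodeSet hn (hu hu0) fun a ha => ?_)
    have h1 := huc a (nodeSet_subset_criticalGrid n d ha)
    have h2 : c a = 0 := dif_neg fun h => (Finset.mem_sdiff.mp h).2 ha
    rw [h2, eq_comm, mul_eq_zero] at h1
    exact h1.resolve_left (gridWeight_ne_zero d a)
  apply hφ0
  ext a
  have h1 := huc a.1 (Finset.mem_sdiff.mp a.2).1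
  rw [hu0, map_zero, mul_zero] at h1
  simp only [c] at h1
  rw [dif_pos a.2] at h1
  simpa using h1

/-- Such a function is realized by a multiple of the partial along `x₀`, the cofactor interpolating
its quotient by `d F` off the nodes. The cofactor has degree `k - (d-1)`, which reaches `(n-1)(d-2)`
precisely from `k = n(d-2) + 1` on. -/
theorem ker_restrictToNodes_le {n d k : ℕ} (hn : 2 ≤ n) (hd : 2 ≤ d)
    (hk : n * (d - 2) + 1 ≤ k) :
    LinearMap.ker (restrictToNodes n d) ≤ jacobianValues n d k := by
  classical
  intro v hv
  rw [mem_ker_restrictToNodes] at hv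
  obtain ⟨h, hdeg, hh⟩ := exists_totalDegree_le_forall_eval_eq hn hd fun a =>
    v ⟨a.1, (Finset.mem_sdiff.mp a.2).1⟩ / (d * eval a.1 (affineEquation n d))
  have hd0 : (d : ℂ) ≠ 0 := by exact_mod_cast (by omega : d ≠ 0)
  have hn' : n * (d - 2) = (n - 1) * (d - 2) + (d - 2) := by
    obtain ⟨m, rfl⟩ := Nat.exists_eq_add_of_le' hn
    simp [add_mul]
    ring
  have hhom : (homogenizeAt (k - (d - 1)) h * pderiv 0 (equation n d)).IsHomogeneous k := by
    have := (isHomogeneous_homogenizeAt (k := k - (d - 1)) (g := h) (by omega)).mul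
      ((isHomogeneous_equation (n := n) (d := d) (by omega)).pderiv (i := 0))
    convert this using 1
    omega
  refine ⟨⟨_, hhom⟩, ?_, ?_⟩
  · rw [SetLike.mem_coe, mem_ker_toMilnorAlgebra]
    exact Ideal.mul_mem_left _ _ (Ideal.subset_span ⟨0, rfl⟩)
  · ext a
    change eval (Fin.cons 1 a.1 : Fin (n + 1) → ℂ)
      (homogenizeAt (k - (d - 1)) h * pderiv 0 (equation n d)) = v a
    rw [map_mul, ← eval_dehomogenization_zero, dehomogenization_homogenizeAt,
      eval_pderiv_zero_equation (by omega) (by omega) a.2]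
    by_cases ha : a.1 ∈ nodeSet n d
    · rw [hv a ha, (mem_nodeSet.mp ha).2, mul_zero, mul_zero]
    · have hF : eval a.1 (affineEquation n d) ≠ 0 := fun h0 =>
        ha (mem_nodeSet.mpr ⟨mem_criticalGrid.mp a.2, h0⟩)
      rw [hh ⟨a.1, Finset.mem_sdiff.mpr ⟨a.2, ha⟩⟩]
      field_simp

theorem finrank_milnorPiece_eq_card_nodeSet {n d k : ℕ} (hn : 2 ≤ n) (hd : 2 ≤ d)
    (hk : n * (d - 2) + 1 ≤ k) :
    Module.finrank ℂ (milnorPiece (equation n d) k) = (nodeSet n d).card := by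
  have h1 := finrank_milnorPiece_add (by omega) hd ((Nat.le_succ _).trans hk)
  have h2 := finrank_ker_restrictToNodes_add n d
  rw [le_antisymm (jacobianValues_le (by omega) (by omega)) (ker_restrictToNodes_le hn hd hk)] at h1
  omega

/-! ### Degree `n(d-2)`: the dimension is too large -/

/-- Multiples of the partials along `x₁, …, xₙ` vanish on the grid. There the partial along `x₀`
agrees with a polynomial of degree `d - 2` instead of `d - 1`, so its multiples fall below the socle
degree and have residue zero. -/
theorem sum_gridWeight_mul_eval_eq_zero {n d : ℕ} (hn : 1 ≤ n) (hd : 2 ≤ d)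
    {H : MvPolynomial (Fin (n + 1)) ℂ} (hH : H ∈ jacobianIdeal (equation n d)) :
    ∑ a ∈ criticalGrid n d, gridWeight d a * eval (Fin.cons 1 a : Fin (n + 1) → ℂ)
      (homogeneousComponent (n * (d - 2)) H) = 0 := by
  obtain ⟨c, rfl⟩ := Ideal.mem_span_range_iff_exists_fun.mp hH
  simp_rw [map_sum, Finset.mul_sum]
  rw [Finset.sum_comm]
  refine Finset.sum_eq_zero fun i _ => ?_
  -- The coefficients need not be homogeneous; only the component whose product with the partial has
  -- degree `n(d-2)` survives.
  conv_lhs => rw [← sum_homogeneousComponent (c i)]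
  simp_rw [Finset.sum_mul, map_sum, Finset.mul_sum]
  rw [Finset.sum_comm]
  refine Finset.sum_eq_zero fun j _ => ?_
  have hhom := (homogeneousComponent_isHomogeneous j (c i)).mul
    ((isHomogeneous_equation (d := d) hn).pderiv (i := i))
  rw [homogeneousComponent_of_mem hhom]
  split_ifs with hj
  swap
  · simp
  clear hhom
  generalize hp : homogeneousComponent j (c i) = p
  have hpj : p.IsHomogeneous j := hp ▸ homogeneousComponent_isHomogeneous j (c i)
  refine Fin.cases ?_ (fun i => ?_) i
  · obtain ⟨u, hu, hua⟩ := exists_totalDegree_le_eval_eq (n := n) hd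
    have hdeg : (dehomogenization 0 p * u).totalDegree < n * (d - 2) := by
      have h1 := totalDegree_mul (dehomogenization 0 p) u
      have h2 : (dehomogenization 0 p).totalDegree ≤ j := by
        refine (totalDegree_aeval_le _ (fun i => ?_) _).trans hpj.totalDegree_le
        refine Fin.cases ?_ (fun j => ?_) i <;> simp [Fin.insertNth_zero', totalDegree_X]
      omega
    have h0 := sum_gridWeight_mul_eval hd hdeg.le
    rw [coeff_eq_zero_of_totalDegree_lt (by
      rw [← Finsupp.degree_apply, degree_socleExponent]; exact hdeg)] at h0
    rw [← h0]
    refine Finset.sum_congr rfl fun a ha => ?_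
    rw [map_mul, map_mul, eval_pderiv_zero_equation hn (by omega) ha, hua a ha,
      eval_dehomogenization_zero]
  · refine Finset.sum_eq_zero fun a ha => ?_
    rw [map_mul, eval_pderiv_succ_equation hn (by omega),
      Finset.prod_eq_zero (mem_criticalGrid.mp ha i) (by simp)]
    simp

/-- With every coordinate of critical value `-1`, the equation takes the value `-n` or `1 - n`,
nonzero for `n ≥ 2`. -/
theorem exists_mem_criticalGrid_notMem_nodeSet {n d : ℕ} (hn : 2 ≤ n) (hd : 2 ≤ d) :
    ∃ a ∈ criticalGrid n d, a ∉ nodeSet n d := by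
  have hcard : 0 < (criticalFiber d (-1)).card := by
    rw [card_criticalFiber_neg_one]
    omega
  obtain ⟨q, hq⟩ := Finset.card_pos.mp hcard
  obtain ⟨hq, hq1⟩ := Finset.mem_filter.mp hq
  refine ⟨fun _ => q, mem_criticalGrid.mpr fun _ => hq, fun h => ?_⟩
  have h2 := (mem_nodeSet.mp h).2
  rw [eval_affineEquation] at h2
  simp only [hq1, Finset.sum_const, Finset.card_univ, Fintype.card_fin, nsmul_eq_mul] at h2
  split_ifs at h2
  · have : (n : ℂ) = 0 := by linear_combination -h2
    have : n = 0 := by exact_mod_cast this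
    omega
  · have : (n : ℂ) = 1 := by linear_combination -h2
    have : n = 1 := by exact_mod_cast this
    omega

/-- The indicator of a grid point outside the nodes has residue equal to its nonzero weight, so it
vanishes at the nodes without coming from the Jacobian ideal. -/
theorem card_nodeSet_lt_finrank_milnorPiece {n d : ℕ} (hn : 2 ≤ n) (hd : 2 ≤ d) :
    (nodeSet n d).card < Module.finrank ℂ (milnorPiece (equation n d) (n * (d - 2))) := by
  classical
  have h1 := finrank_milnorPiece_add (n := n) (by omega) hd le_rfl
  have h2 := finrank_ker_restrictToNodes_add n d
  have hlt : jacobianValues n d (n * (d - 2)) < LinearMap.ker (restrictToNodes n d) := by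
    refine lt_of_le_of_ne (jacobianValues_le (by omega) (by omega)) fun heq => ?_
    obtain ⟨a, ha, ha'⟩ := exists_mem_criticalGrid_notMem_nodeSet hn hd
    have hmem : (Pi.single ⟨a, ha⟩ 1 : criticalGrid n d → ℂ) ∈
        jacobianValues n d (n * (d - 2)) := by
      rw [heq, mem_ker_restrictToNodes]
      intro b hb
      refine Pi.single_eq_of_ne (fun h => ha' ?_) _
      rw [h] at hb
      exact hb
    obtain ⟨H, hH, hHa⟩ := hmem
    have h3 := sum_gridWeight_mul_eval_eq_zero (by omega) hd (mem_ker_toMilnorAlgebra.mp hH)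
    rw [homogeneousComponent_eq_self H.2, ← Finset.sum_coe_sort,
      Finset.sum_eq_single ⟨a, ha⟩] at h3
    · have h4 : eval (Fin.cons 1 a : Fin (n + 1) → ℂ) H.1 = 1 := by
        exact (congrFun hHa ⟨a, ha⟩).trans (Pi.single_eq_same _ _)
      rw [h4, mul_one] at h3
      exact gridWeight_ne_zero d a h3
    · intro b _ hb
      have h4 : eval (Fin.cons 1 b.1 : Fin (n + 1) → ℂ) H.1 = 0 := by
        exact (congrFun hHa b).trans (Pi.single_eq_of_ne hb _)
      rw [h4, mul_zero]
    · simp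
  have h3 := Submodule.finrank_lt_finrank_of_lt hlt
  omega

/-! ### Tjurina numbers and Hessians at the nodes -/

theorem isUnit_algebraMap_localRingAt {n : ℕ} {a : Fin n → ℂ} {s : MvPolynomial (Fin n) ℂ}
    (hs : eval a s ≠ 0) : IsUnit (algebraMap (MvPolynomial (Fin n) ℂ) (LocalRingAt a) s) :=
  (IsLocalization.AtPrime.isUnit_to_map_iff (LocalRingAt a)
    (RingHom.ker (eval a : MvPolynomial (Fin n) ℂ →+* ℂ)) s).mpr fun h => hs h

/-- In the factorization of the `j`-th partial, all factors except `X_j - a_j` are nonzero at `a`,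
hence units in the local ring, because critical points are simple. -/
theorem X_sub_C_mem_tjurinaIdeal {n d : ℕ} (hd : 1 ≤ d) {a : Fin n → ℂ}
    (ha : a ∈ nodeSet n d) (j : Fin n) :
    algebraMap (MvPolynomial (Fin n) ℂ) (LocalRingAt a) (X j - C (a j)) ∈
      tjurinaIdeal (affineEquation n d) a := by
  have hmem : algebraMap (MvPolynomial (Fin n) ℂ) (LocalRingAt a)
      (pderiv j (affineEquation n d)) ∈ tjurinaIdeal (affineEquation n d) a :=
    Ideal.mem_map_of_mem _ (Ideal.subset_span (Set.mem_insert_of_mem _ ⟨j, rfl⟩))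
  have haj := (mem_nodeSet.mp ha).1 j
  rw [pderiv_affineEquation_eq_prod (by omega), ← Finset.mul_prod_erase _ _ haj, mul_left_comm,
    map_mul] at hmem
  refine (Ideal.mul_unit_mem_iff_mem _ (isUnit_algebraMap_localRingAt ?_)).mp hmem
  rw [map_mul, eval_C, map_prod]
  refine mul_ne_zero (derivLeadingCoeff_ne_zero (by omega)) (Finset.prod_ne_zero_iff.mpr ?_)
  intro q hq
  simpa [sub_eq_zero] using (Finset.ne_of_mem_erase hq).symm

theorem sub_C_eval_mem_tjurinaIdeal {n d : ℕ} (hd : 1 ≤ d) {a : Fin n → ℂ}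
    (ha : a ∈ nodeSet n d) (p : MvPolynomial (Fin n) ℂ) :
    algebraMap (MvPolynomial (Fin n) ℂ) (LocalRingAt a) (p - C (eval a p)) ∈
      tjurinaIdeal (affineEquation n d) a := by
  induction p using MvPolynomial.induction_on with
  | C c => simp
  | add p q hp hq =>
    have := Ideal.add_mem _ hp hq
    rw [← map_add] at this
    convert this using 2
    simp only [map_add]
    ring
  | mul_X p i hp =>
    have := Ideal.add_mem _ (Ideal.mul_mem_left _
      (algebraMap (MvPolynomial (Fin n) ℂ) (LocalRingAt a) p) (X_sub_C_mem_tjurinaIdeal hd ha i))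
      (Ideal.mul_mem_left _
      (algebraMap (MvPolynomial (Fin n) ℂ) (LocalRingAt a) (C (a i))) hp)
    rw [← map_mul, ← map_mul, ← map_add] at this
    convert this using 2
    simp only [map_mul, eval_X]
    ring

theorem tjurinaIdeal_ne_top {n d : ℕ} (hd : 1 ≤ d) {a : Fin n → ℂ} (ha : a ∈ nodeSet n d) :
    tjurinaIdeal (affineEquation n d) a ≠ ⊤ := by
  intro htop
  have hle : tjurinaIdeal (affineEquation n d) a ≤
      IsLocalRing.maximalIdeal (LocalRingAt a) := by
    rw [tjurinaIdeal, ← Localization.AtPrime.map_eq_maximalIdeal]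
    refine Ideal.map_mono (Ideal.span_le.mpr ?_)
    rintro _ (rfl | ⟨j, rfl⟩)
    · exact (mem_nodeSet.mp ha).2
    · change eval a (pderiv j (affineEquation n d)) = 0
      rw [pderiv_affineEquation_eq_prod (by omega), map_mul, map_prod,
        Finset.prod_eq_zero ((mem_nodeSet.mp ha).1 j) (by simp), mul_zero]
  rw [htop] at hle
  exact Ideal.IsPrime.ne_top' (top_le_iff.mp hle)

/-- Modulo the Tjurina ideal a fraction `r/s` equals the scalar `r(a)/s(a)`, so the Tjurina algebra
is `ℂ`. -/
theorem tjurinaNumber_eq_one {n d : ℕ} (hd : 1 ≤ d) {a : Fin n → ℂ} (ha : a ∈ nodeSet n d) :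
    tjurinaNumber (affineEquation n d) a = 1 := by
  have := Ideal.Quotient.nontrivial_iff.mpr (tjurinaIdeal_ne_top hd ha)
  have hbij : Function.Bijective
      (Algebra.linearMap ℂ (LocalRingAt a ⧸ tjurinaIdeal (affineEquation n d) a)) := by
    refine ⟨(algebraMap ℂ (LocalRingAt a ⧸ tjurinaIdeal (affineEquation n d) a)).injective, ?_⟩
    intro y
    obtain ⟨y, rfl⟩ := Ideal.Quotient.mk_surjective y
    obtain ⟨r, s, rfl⟩ := IsLocalization.exists_mk'_eq
      (RingHom.ker (eval a : MvPolynomial (Fin n) ℂ →+* ℂ)).primeCompl y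
    have hs : eval a s.1 ≠ 0 := fun h => s.2 h
    refine ⟨eval a r / eval a s.1, ?_⟩
    rw [Algebra.linearMap_apply, IsScalarTower.algebraMap_apply ℂ (LocalRingAt a),
      Ideal.Quotient.algebraMap_eq, eq_comm, Ideal.Quotient.eq,
      ← Ideal.unit_mul_mem_iff_mem _ (isUnit_algebraMap_localRingAt hs), mul_sub,
      IsLocalization.mk'_spec', IsScalarTower.algebraMap_apply ℂ (MvPolynomial (Fin n) ℂ),
      ← map_mul, ← map_sub]
    have h := sub_C_eval_mem_tjurinaIdeal hd ha (r - s.1 * C (eval a r / eval a s.1))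
    have h0 : eval a (r - s.1 * C (eval a r / eval a s.1)) = 0 := by
      rw [map_sub, map_mul, eval_C, mul_div_cancel₀ _ hs, sub_self]
    rwa [h0, C_0, sub_zero] at h
  rw [tjurinaNumber, Cardinal.toENat_eq_one,
    ← (LinearEquiv.ofBijective _ hbij).rank_eq, CommSemiring.rank_self]

theorem eval_derivative_derivative_T_ne_zero {d : ℕ} (hd : d ≠ 0) {q : ℂ}
    (hq : q ∈ criticalPoints d) :
    (Polynomial.derivative (Polynomial.derivative (Polynomial.Chebyshev.T ℂ d))).eval q ≠ 0 := by
  have hsep : (Polynomial.derivative (Polynomial.Chebyshev.T ℂ d)).Separable := by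
    rw [derivative_T_eq_prod hd]
    refine Polynomial.Separable.unit_mul
      (Polynomial.isUnit_C.mpr (derivLeadingCoeff_ne_zero hd).isUnit) ?_
    exact Polynomial.separable_prod_X_sub_C_iff'.mpr fun x _ y _ h => h
  rw [← Polynomial.coe_aeval_eq_eval]
  refine hsep.aeval_derivative_ne_zero ?_
  rw [Polynomial.coe_aeval_eq_eval, derivative_T_eq_prod hd, Polynomial.eval_mul,
    Polynomial.eval_prod, Finset.prod_eq_zero hq (by simp), mul_zero]

/-- The variables are separated, so the Hessian is diagonal with entries `T_d''(a_i)`, nonzero since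
`T_d'` has simple roots. -/
theorem det_hessian_affineEquation_ne_zero {n d : ℕ} (hd : d ≠ 0) {a : Fin n → ℂ}
    (ha : a ∈ nodeSet n d) : (hessian (affineEquation n d) a).det ≠ 0 := by
  have h : hessian (affineEquation n d) a = Matrix.diagonal fun i =>
      (Polynomial.derivative (Polynomial.derivative (Polynomial.Chebyshev.T ℂ d))).eval (a i) := by
    ext i j
    rw [hessian, Matrix.of_apply, pderiv_affineEquation, Derivation.map_aeval, smul_eq_mul,
      map_mul, Matrix.diagonal_apply]
    split_ifs with hij
    · subst hij
      rw [pderiv_X_self, map_one, mul_one, ← coe_aeval_eq_eval, RingHom.coe_coe,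
        ← Polynomial.aeval_algHom_apply, aeval_X, Polynomial.coe_aeval_eq_eval]
    · rw [pderiv_X_of_ne (Ne.symm hij), map_zero, mul_zero]
  rw [h, Matrix.det_diagonal]
  exact Finset.prod_ne_zero_iff.mpr fun i _ =>
    eval_derivative_derivative_T_ne_zero hd ((mem_nodeSet.mp ha).1 i)

/-! ### The singular locus in projective space -/

/-- At `x₀ = 0` the partials along `x₁, …, xₙ` are nonzero multiples of `x_j^(d-1)`, so there is no
singular point at infinity. Conversely, where `x₀ ≠ 0`, Euler's relation gives the vanishing of the
partial along `x₀`. -/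
theorem mem_singularLocus_equation_iff {n d : ℕ} (hn : 1 ≤ n) (hd : 2 ≤ d)
    (p : ℙ ℂ (Fin (n + 1) → ℂ)) :
    p ∈ singularLocus (equation n d) ↔
      p.rep 0 ≠ 0 ∧ (fun j : Fin n => p.rep j.succ / p.rep 0) ∈ nodeSet n d := by
  have hhom := isHomogeneous_equation (n := n) (d := d) hn
  have hlc := derivLeadingCoeff_ne_zero (d := d) (by omega)
  constructor
  · rintro ⟨h0, h⟩
    have hj : ∀ j : Fin n, ∃ q ∈ criticalPoints d, p.rep j.succ = q * p.rep 0 := by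
      intro j
      have h1 := h j.succ
      rw [eval_pderiv_succ_equation hn (by omega), mul_eq_zero, Finset.prod_eq_zero_iff] at h1
      obtain ⟨q, hq, h2⟩ := h1.resolve_left hlc
      exact ⟨q, hq, sub_eq_zero.mp h2⟩
    have hx : p.rep 0 ≠ 0 := by
      intro hx
      apply p.rep_nonzero
      ext i
      refine Fin.cases hx (fun j => ?_) i
      obtain ⟨q, _, h2⟩ := hj j
      rw [h2, hx, mul_zero]
      rfl
    refine ⟨hx, mem_nodeSet.mpr ⟨fun j => ?_, ?_⟩⟩
    · obtain ⟨q, hq, h2⟩ := hj j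
      simpa [h2, hx] using hq
    · rw [eval_eq_pow_mul_eval_dehomogenization hhom hx, dehomogenization_equation hn] at h0
      exact (mul_eq_zero.mp h0).resolve_left (pow_ne_zero _ hx)
  · rintro ⟨hx, hmem⟩
    obtain ⟨hcrit, hF⟩ := mem_nodeSet.mp hmem
    have h0 : eval p.rep (equation n d) = 0 := by
      rw [eval_eq_pow_mul_eval_dehomogenization hhom hx, dehomogenization_equation hn, hF,
        mul_zero]
    have hsucc : ∀ j : Fin n, eval p.rep (pderiv j.succ (equation n d)) = 0 := by
      intro j
      rw [eval_pderiv_succ_equation hn (by omega), Finset.prod_eq_zero (hcrit j), mul_zero]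
      field_simp
      ring
    refine ⟨h0, fun i => Fin.cases ?_ hsucc i⟩
    have h1 := congrArg (eval p.rep) hhom.sum_X_mul_pderiv
    rw [Fin.sum_univ_succ, map_add, map_sum, Finset.sum_eq_zero, add_zero, map_mul, eval_X,
      map_nsmul, h0, smul_zero] at h1
    · exact (mul_eq_zero.mp h1).resolve_left hx
    · intro j _
      rw [map_mul, hsucc, mul_zero]

theorem chartIndex_eq_zero {n : ℕ} {p : ℙ ℂ (Fin (n + 1) → ℂ)} (hp : p.rep 0 ≠ 0) :
    chartIndex p = 0 := by
  rw [chartIndex, Fin.find_eq_zero]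
  exact hp

theorem affineCoords_mem_nodeSet {n d : ℕ} (hn : 1 ≤ n) (hd : 2 ≤ d)
    {p : ℙ ℂ (Fin (n + 1) → ℂ)} (hp : p ∈ singularLocus (equation n d)) :
    chartIndex p = 0 ∧ affineCoords p ∈ nodeSet n d := by
  obtain ⟨hx, hmem⟩ := (mem_singularLocus_equation_iff hn hd p).mp hp
  have h0 := chartIndex_eq_zero hx
  refine ⟨h0, ?_⟩
  unfold affineCoords
  rw [h0]
  exact hmem

theorem isNode_of_mem_singularLocus {n d : ℕ} (hn : 1 ≤ n) (hd : 2 ≤ d)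
    {p : ℙ ℂ (Fin (n + 1) → ℂ)} (hp : p ∈ singularLocus (equation n d)) :
    IsNode (equation n d) p := by
  obtain ⟨h0, hmem⟩ := affineCoords_mem_nodeSet hn hd hp
  refine ⟨hp, ?_⟩
  rw [h0, dehomogenization_equation hn]
  exact det_hessian_affineEquation_ne_zero (by omega) hmem

theorem cons_one_ne_zero {n : ℕ} (a : Fin n → ℂ) : (Fin.cons 1 a : Fin (n + 1) → ℂ) ≠ 0 :=
  fun h => one_ne_zero (congrFun h 0)

theorem singularLocus_equation_eq_image {n d : ℕ} (hn : 1 ≤ n) (hd : 2 ≤ d) :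
    singularLocus (equation n d) =
      (fun a : Fin n → ℂ => Projectivization.mk ℂ (Fin.cons 1 a : Fin (n + 1) → ℂ)
        (cons_one_ne_zero a)) '' (nodeSet n d : Set (Fin n → ℂ)) := by
  ext p
  rw [mem_singularLocus_equation_iff hn hd]
  constructor
  · rintro ⟨hx, hmem⟩
    refine ⟨_, hmem, ?_⟩
    conv_rhs => rw [← p.mk_rep]
    rw [Projectivization.mk_eq_mk_iff']
    refine ⟨(p.rep 0)⁻¹, ?_⟩
    ext i
    refine Fin.cases ?_ (fun j => ?_) i
    · simp [hx]
    · simp [div_eq_inv_mul]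
  · rintro ⟨a, ha, rfl⟩
    obtain ⟨c, hc⟩ := Projectivization.exists_smul_eq_mk_rep ℂ
      (Fin.cons 1 a : Fin (n + 1) → ℂ) (cons_one_ne_zero a)
    rw [← hc]
    constructor
    · simp [Units.smul_def]
    · convert Finset.mem_coe.mp ha using 1
      ext j
      simp [Units.smul_def]

theorem encard_singularLocus_equation {n d : ℕ} (hn : 1 ≤ n) (hd : 2 ≤ d) :
    (singularLocus (equation n d)).encard = (nodeSet n d).card := by
  rw [singularLocus_equation_eq_image hn hd, Set.InjOn.encard_image, Set.encard_coe_eq_coe_finsetCard]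
  intro a _ b _ hab
  obtain ⟨c, hc⟩ := (Projectivization.mk_eq_mk_iff' _ _ _ _ _).mp hab
  have h0 : c = 1 := by simpa using congrFun hc 0
  ext j
  have := congrFun hc j.succ
  rw [h0] at this
  simpa using this.symm

theorem numberOfNodes_equation {n d : ℕ} (hn : 1 ≤ n) (hd : 2 ≤ d) :
    numberOfNodes (equation n d) = (nodeSet n d).card := by
  rw [numberOfNodes, ← encard_singularLocus_equation hn hd]
  congr 1
  ext p
  exact ⟨fun h => h.1, isNode_of_mem_singularLocus hn hd⟩

theorem totalTjurinaNumber_equation {n d : ℕ} (hn : 1 ≤ n) (hd : 2 ≤ d) :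
    totalTjurinaNumber (equation n d) = (nodeSet n d).card := by
  have hcard := encard_singularLocus_equation hn hd
  have hfin : (singularLocus (equation n d)).Finite := by
    rw [← Set.encard_ne_top_iff, hcard]
    exact ENat.natCast_ne_top _
  have := hfin.fintype
  rw [totalTjurinaNumber, tsum_fintype, Finset.sum_congr rfl (g := fun _ => 1), ← hcard]
  · rw [Set.encard_eq_coe_toFinset_card, Set.toFinset_card, Finset.sum_const, Finset.card_univ,
      nsmul_one]
  · intro p _
    obtain ⟨h0, hmem⟩ := affineCoords_mem_nodeSet hn hd p.2
    rw [h0, dehomogenization_equation hn]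
    exact tjurinaNumber_eq_one (by omega) hmem

/-! ### Counting the nodes -/

theorem mem_criticalFiber {d : ℕ} {s x : ℂ} :
    x ∈ criticalFiber d s ↔
      x ∈ criticalPoints d ∧ (Polynomial.Chebyshev.T ℂ d).eval x = s :=
  Finset.mem_filter

/-- The indices of the coordinates with critical value `1`. -/
noncomputable def plusIndices {n : ℕ} (d : ℕ) (a : Fin n → ℂ) : Finset (Fin n) :=
  Finset.univ.filter fun i => a i ∈ criticalFiber d 1

theorem mem_plusIndices {n d : ℕ} {a : Fin n → ℂ} {i : Fin n} :
    i ∈ plusIndices d a ↔ a i ∈ criticalFiber d 1 := by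
  simp [plusIndices]

theorem sum_eval_T_eq {n d : ℕ} {a : Fin n → ℂ} (ha : a ∈ criticalGrid n d) :
    ∑ i, (Polynomial.Chebyshev.T ℂ d).eval (a i) =
      2 * (plusIndices d a).card - n := by
  have h : ∀ i, (Polynomial.Chebyshev.T ℂ d).eval (a i) =
      2 * (if a i ∈ criticalFiber d 1 then 1 else 0) - 1 := by
    intro i
    have hi := mem_criticalGrid.mp ha i
    rcases eval_T_of_mem_criticalPoints hi with h | h
    · have : a i ∈ criticalFiber d 1 := mem_criticalFiber.mpr ⟨hi, h⟩
      rw [if_pos this, h]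
      norm_num
    · have : a i ∉ criticalFiber d 1 := fun h' => by
        rw [(mem_criticalFiber.mp h').2] at h
        norm_num at h
      rw [if_neg this, h]
      norm_num
  rw [Finset.sum_congr rfl fun i _ => h i, Finset.sum_sub_distrib, ← Finset.mul_sum,
    Finset.sum_boole, plusIndices]
  simp

/-- With `k` coordinates of value `1` the equation reads `2k - n = 0` for `n` even and `2k - n + 1 =
0` for `n` odd; both say `k = ⌊n/2⌋`. -/
theorem mem_nodeSet_iff_card {n d : ℕ} {a : Fin n → ℂ} (ha : a ∈ criticalGrid n d) :
    a ∈ nodeSet n d ↔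
      (plusIndices d a).card = n / 2 := by
  rw [mem_nodeSet, and_iff_right (mem_criticalGrid.mp ha), eval_affineEquation, sum_eval_T_eq ha]
  set k := (plusIndices d a).card
  split_ifs with he
  · have : (2 * (k : ℂ) - n + 0 = 0) ↔ 2 * k = n := by
      rw [add_zero, sub_eq_zero]
      norm_cast
    rw [this]
    obtain ⟨m, rfl⟩ := he
    omega
  · have : (2 * (k : ℂ) - n + 1 = 0) ↔ 2 * k + 1 = n := by
      rw [sub_add_eq_add_sub, sub_eq_zero]
      norm_cast
    rw [this]
    obtain ⟨m, rfl⟩ := Nat.not_even_iff_odd.mp he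
    omega

/-- Nodes are sorted by the set of coordinates with value `1`; over a fixed set of `⌊n/2⌋` indices
they form a product of critical fibers. -/
theorem card_nodeSet (n d : ℕ) :
    (nodeSet n d).card =
      n.choose (n / 2) * ((d - 1) / 2) ^ (n / 2) * (d / 2) ^ (n - n / 2) := by
  have hmaps : ∀ a ∈ nodeSet n d, (plusIndices d a) ∈
      Finset.powersetCard (n / 2) (Finset.univ : Finset (Fin n)) := fun a ha =>
    Finset.mem_powersetCard.mpr ⟨Finset.subset_univ _,
      (mem_nodeSet_iff_card (nodeSet_subset_criticalGrid n d ha)).mp ha⟩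
  rw [Finset.card_eq_sum_card_fiberwise hmaps,
    Finset.sum_congr rfl (g := fun _ => ((d - 1) / 2) ^ (n / 2) * (d / 2) ^ (n - n / 2))]
  · simp [mul_assoc]
  · intro I hI
    obtain ⟨_, hIcard⟩ := Finset.mem_powersetCard.mp hI
    have hfib : ((nodeSet n d).filter fun a =>
        (plusIndices d a) = I) =
        Fintype.piFinset fun i => if i ∈ I then criticalFiber d 1 else criticalFiber d (-1) := by
      ext a
      rw [Finset.mem_filter, Fintype.mem_piFinset]
      constructor
      · rintro ⟨ha, rfl⟩ i
        have hi := (mem_nodeSet.mp ha).1 i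
        split_ifs with h
        · exact mem_plusIndices.mp h
        · rw [mem_plusIndices, mem_criticalFiber, not_and] at h
          exact mem_criticalFiber.mpr ⟨hi, (eval_T_of_mem_criticalPoints hi).resolve_left (h hi)⟩
      · intro h
        have hgrid : a ∈ criticalGrid n d := mem_criticalGrid.mpr fun i => by
          have := h i
          split_ifs at this
          · exact (mem_criticalFiber.mp this).1
          · exact (mem_criticalFiber.mp this).1
        have hI : plusIndices d a = I := by
          ext i
          rw [mem_plusIndices]
          have := h i
          split_ifs at this with hi
          · exact iff_of_true this hi
          · refine iff_of_false (fun h' => ?_) hi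
            have h1 := (mem_criticalFiber.mp this).2
            rw [(mem_criticalFiber.mp h').2] at h1
            norm_num at h1
        exact ⟨(mem_nodeSet_iff_card hgrid).mpr (hI ▸ hIcard), hI⟩
    rw [hfib, Fintype.card_piFinset]
    simp_rw [apply_ite Finset.card, card_criticalFiber_one, card_criticalFiber_neg_one]
    rw [Finset.prod_ite, Finset.prod_const, Finset.prod_const, Finset.filter_not]
    simp [hIcard, Finset.card_sdiff]

/-! ### The stability threshold and the main theorem -/

theorem isStabilityThreshold_equation {n d : ℕ} (hn : 2 ≤ n) (hd : 2 ≤ d) :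
    IsStabilityThreshold (equation n d) (n * (d - 2) + 1) := by
  constructor
  · intro k hk
    rw [finrank_milnorPiece_eq_card_nodeSet hn hd hk, totalTjurinaNumber_equation (by omega) hd]
  · intro q hq
    by_contra! hlt
    -- A smaller threshold would already impose equality in degree `n(d-2)`, where the inequality is
    -- strict.
    have h := hq (n * (d - 2)) (by omega)
    rw [totalTjurinaNumber_equation (by omega) hd, Nat.cast_inj] at h
    exact (card_nodeSet_lt_finrank_milnorPiece hn hd).ne' h

end ChebyshevHypersurface

open ChebyshevHypersurface in
theorem corollary3p2 (n d : ℕ) (hn : 2 ≤ n) (hd : 2 ≤ d) :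
    -- the stability threshold
    (∃ st : ℕ, IsStabilityThreshold (equation n d) st ∧
      (st : ℤ) = ((n : ℤ) + 1) * ((d : ℤ) - 2) - ((d : ℤ) - 3) ∧
      (st : ℤ) = (n : ℤ) * ((d : ℤ) - 2) + 1) ∧
    -- all singular points are nodes, and the total Tjurina number is the number of nodes
    (∀ p ∈ singularLocus (equation n d), IsNode (equation n d) p) ∧
    totalTjurinaNumber (equation n d) = numberOfNodes (equation n d) ∧
    -- the number of nodes
    (∀ n₁ d₁ : ℕ, n = 2 * n₁ → d = 2 * d₁ + 1 →
      numberOfNodes (equation n d) = (((2 * n₁).choose n₁ * d₁ ^ n : ℕ) : ℕ∞)) ∧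
    (∀ n₁ d₁ : ℕ, n = 2 * n₁ → d = 2 * d₁ →
      numberOfNodes (equation n d) =
        (((2 * n₁).choose n₁ * d₁ ^ n₁ * (d₁ - 1) ^ n₁ : ℕ) : ℕ∞)) ∧
    (∀ n₁ d₁ : ℕ, n = 2 * n₁ + 1 → d = 2 * d₁ →
      numberOfNodes (equation n d) =
        (((2 * n₁ + 1).choose n₁ * d₁ ^ (n₁ + 1) * (d₁ - 1) ^ n₁ : ℕ) : ℕ∞)) ∧
    (∀ n₁ d₁ : ℕ, n = 2 * n₁ + 1 → d = 2 * d₁ + 1 →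
      numberOfNodes (equation n d) = (((2 * n₁ + 1).choose n₁ * d₁ ^ n : ℕ) : ℕ∞)) := by

  have hn1 : 1 ≤ n := by omega
  refine ⟨⟨_, isStabilityThreshold_equation hn hd, ?_, ?_⟩,
    fun p hp => isNode_of_mem_singularLocus hn1 hd hp, ?_, ?_, ?_, ?_, ?_⟩
  · push_cast [Nat.cast_sub hd]
    ring
  · push_cast [Nat.cast_sub hd]
    ring
  · rw [totalTjurinaNumber_equation hn1 hd, numberOfNodes_equation hn1 hd]
  · rintro n₁ d₁ rfl rfl
    rw [numberOfNodes_equation hn1 hd, card_nodeSet, show 2 * n₁ / 2 = n₁ by omega,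
      show (2 * d₁ + 1 - 1) / 2 = d₁ by omega, show (2 * d₁ + 1) / 2 = d₁ by omega,
      mul_assoc, ← pow_add, show n₁ + (2 * n₁ - n₁) = 2 * n₁ by omega]
  · rintro n₁ d₁ rfl rfl
    rw [numberOfNodes_equation hn1 hd, card_nodeSet, show 2 * n₁ / 2 = n₁ by omega,
      show (2 * d₁ - 1) / 2 = d₁ - 1 by omega, show 2 * d₁ / 2 = d₁ by omega,
      show 2 * n₁ - n₁ = n₁ by omega, mul_right_comm]
  · rintro n₁ d₁ rfl rfl
    rw [numberOfNodes_equation hn1 hd, card_nodeSet, show (2 * n₁ + 1) / 2 = n₁ by omega,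
      show (2 * d₁ - 1) / 2 = d₁ - 1 by omega, show 2 * d₁ / 2 = d₁ by omega,
      show 2 * n₁ + 1 - n₁ = n₁ + 1 by omega, mul_right_comm]
  · rintro n₁ d₁ rfl rfl
    rw [numberOfNodes_equation hn1 hd, card_nodeSet, show (2 * n₁ + 1) / 2 = n₁ by omega,
      show (2 * d₁ + 1 - 1) / 2 = d₁ by omega, show (2 * d₁ + 1) / 2 = d₁ by omega,
      mul_assoc, ← pow_add, show n₁ + (2 * n₁ + 1 - n₁) = 2 * n₁ + 1 by omega]
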